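/- **2-crossed modules.** Let $G,H,L$ be finite groups, with $G$ acting on $H$ and on $L$ by automorphisms (written $\rhd$) and on itself by conjugation, and let $(L\xrightarrow{\delta}H\xrightarrow{\partial}G,\rhd,\{\cdot,\cdot\})$ be a 2-crossed module. That is, $\partial$ and $\delta$ are $G$-equivariant homomorphisms with $\partial\delta=1$, and $\{\cdot,\cdot\}:H\times H\to L$ (the Peiffer lifting) is a $G$-equivariant map such that, with $\langle h_1,h_2\rangle=h_1h_2h_1^{-1}\,(\partial(h_1)\rhd h_2^{-1})$, for all $h,h_1,h_2,h_3\in H$ and $l,l_1,l_2\in L$: - $\delta\{h_1,h_2\}=\langle h_1,h_2\rangle$; - $l_1l_2l_1^{-1}l_2^{-1}=\{\delta(l_1),\delta(l_2)\}$; - $\{h_1h_2,h_3\}=\{h_1,h_2h_3h_2^{-1}\}\,\bigl(\partial(h_1)\rhd\{h_2,h_3\}\bigr)$; - $\{h_1,h_2h_3\}=\{h_1,h_2\}\{h_1,h_3\}\{\langle h_1,h_3\rangle^{-1},\partial(h_1)\rhd h_2\}$; - $\{\delta(l),h\}\{h,\delta(l)\}=l\,(\partial(h)\rhd l^{-1})$.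 Put $h\rhd' l=l\,\{\delta(l)^{-1},h\}$. **State sum.** Let $K$ be a finite simplicial complex with totally ordered vertices, and let $\Lambda_k$ be the set of its $k$-simplices $(i_0\dots i_k)$, $i_0<\dots<i_k$. For a finite group $X$ let $\delta_X(x)=|X|$ if $x=1$ and $\delta_X(x)=0$ otherwise, and let $\int_X dx=\frac1{|X|}\sum_{x\in X}$. Define $$Z(K)=|G|^{-|\Lambda_0|+|\Lambda_1|-|\Lambda_2|}\,|H|^{|\Lambda_0|-|\Lambda_1|+|\Lambda_2|-|\Lambda_3|}\,|L|^{-|\Lambda_0|+|\Lambda_1|-|\Lambda_2|+|\Lambda_3|-|\Lambda_4|}\prod_{(jk)\in\Lambda_1}\int_G dg_{jk}\prod_{(jk\ell)\in\Lambda_2}\int_H dh_{jk\ell}\prod_{(jk\ell m)\in\Lambda_3}\int_L dl_{jk\ell m}\;W,$$ where $W$ is the product of - $\delta_G\bigl(\partial(h_{jk\ell})\,g_{k\ell}\,g_{jk}\,g_{j\ell}^{-1}\bigr)$ over all triangles $(jk\ell)\in\Lambda_2$; - $\delta_H\bigl(\delta(l_{jk\ell m})\,h_{j\ell m}\,(g_{\ell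 m}\rhd h_{jk\ell})\,h_{k\ell m}^{-1}\,h_{jkm}^{-1}\bigr)$ over all tetrahedra $(jk\ell m)\in\Lambda_3$; - $\delta_L\bigl(l_{j\ell mn}^{-1}\,(h_{j\ell n}\rhd'\{h_{\ell mn},(g_{mn}g_{\ell m})\rhd h_{jk\ell}\})\,l_{jk\ell n}^{-1}\,(h_{jkn}\rhd' l_{k\ell mn})\,l_{jkmn}\,(h_{jmn}\rhd'(g_{mn}\rhd l_{jk\ell m}))\bigr)$ over all 4-simplices $(jk\ell mn)\in\Lambda_4$. **Pachner moves.** Let $K$ and $K'$ be finite simplicial complexes with vertices in one totally ordered set, and let $p,q\ge1$ with $p+q=6$. We say that $K'$ arises from $K$ by the Pachner move $p\to q$ if there are sets of vertices $A,B$ with $|A|=q$ and $|B|=p$ such that $A$ is a simplex of $K$ with link $\partial B$, $B$ is not a simplex of $K$, and $K'$ is obtained from $K$ by replacing the subcomplex $A*\partial B$ ($p$ 4-simplices) by $\partial A*B$ ($q$ 4-simplices). **Theorem.** Let $K$ be a closed and oriented combinatorial 4-manifold, that is, an oriented finite simplicial complex with totally ordered vertices in which the link of every vertex is PL homeomorphic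 to the boundary of a 4-simplex. If $K'$ arises from $K$ by one of the Pachner moves $1\to5$, $5\to1$, $2\to4$, $4\to2$, $3\to3$, then $Z(K)=Z(K')$. -/

import Mathlib

open scoped BigOperators

/-! ### 2-crossed modules -/

/-- A 2-crossed module `L --δ--> H --∂--> G` of groups. The actions of `G` on `H` and on `L` by
automorphisms are the `MulDistribMulAction` instances, `G` acts on itself by conjugation, and
`lift` is the Peiffer lifting `{h₁, h₂}`. -/
structure TwoCrossedModule (G H L : Type*) [Group G] [Group H] [Group L]
    [MulDistribMulAction G H] [MulDistribMulAction G L] where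
  /-- the homomorphism `∂ : H → G` -/
  bd : H →* G
  /-- the homomorphism `δ : L → H` -/
  dl : L →* H
  /-- the Peiffer lifting -/
  lift : H → H → L
  bd_dl : ∀ l : L, bd (dl l) = 1
  bd_smul : ∀ (g : G) (h : H), bd (g • h) = g * bd h * g⁻¹
  dl_smul : ∀ (g : G) (l : L), dl (g • l) = g • dl l
  lift_smul : ∀ (g : G) (h₁ h₂ : H), g • lift h₁ h₂ = lift (g • h₁) (g • h₂)
  dl_lift : ∀ h₁ h₂ : H, dl (lift h₁ h₂) = h₁ * h₂ * h₁⁻¹ * bd h₁ • h₂⁻¹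
  lift_dl_dl : ∀ l₁ l₂ : L, l₁ * l₂ * l₁⁻¹ * l₂⁻¹ = lift (dl l₁) (dl l₂)
  lift_mul_left : ∀ h₁ h₂ h₃ : H,
    lift (h₁ * h₂) h₃ = lift h₁ (h₂ * h₃ * h₂⁻¹) * bd h₁ • lift h₂ h₃
  lift_mul_right : ∀ h₁ h₂ h₃ : H,
    lift h₁ (h₂ * h₃) =
      lift h₁ h₂ * lift h₁ h₃ * lift (h₁ * h₃ * h₁⁻¹ * bd h₁ • h₃⁻¹)⁻¹ (bd h₁ • h₂)
  lift_dl_mul_lift_dl : ∀ (h : H) (l : L),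
    lift (dl l) h * lift h (dl l) = l * bd h • l⁻¹

/-- The action `h ▷' l = l {δ(l)⁻¹, h}` of `H` on `L`. -/
def TwoCrossedModule.act {G H L : Type*} [Group G] [Group H] [Group L]
    [MulDistribMulAction G H] [MulDistribMulAction G L] (X : TwoCrossedModule G H L)
    (h : H) (l : L) : L :=
  l * X.lift (X.dl l)⁻¹ h

/-! ### Simplicial complexes and combinatorial manifolds -/

/-- The link of a vertex `v` in an abstract simplicial complex (faces are nonempty). -/
def vertexLink {V : Type*} [DecidableEq V] (K : PreAbstractSimplicialComplex V) (v : V) :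
    PreAbstractSimplicialComplex V where
  faces := {τ | τ.Nonempty ∧ v ∉ τ ∧ insert v τ ∈ K.faces}
  isRelLowerSet_faces := by
    rintro τ ⟨hne, hv, hτ⟩
    refine ⟨hne, fun ρ hρ hρne => ⟨hρne, fun h => hv (hρ h), ?_⟩⟩
    exact (K.isRelLowerSet_faces hτ).2 (Finset.insert_subset_insert v hρ)
      (Finset.insert_nonempty v ρ)

/-- The boundary `∂Δⁿ` of the standard `n`-simplex: all nonempty proper subsets of its `n + 1`
vertices. It is a triangulation of the `(n - 1)`-sphere. -/
def simplexBoundary (n : ℕ) : PreAbstractSimplicialComplex (Fin (n + 1)) where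
  faces := {τ | τ.Nonempty ∧ τ ≠ Finset.univ}
  isRelLowerSet_faces := by
    rintro τ ⟨hne, hτ⟩
    refine ⟨hne, fun ρ hρ hρne => ⟨hρne, fun h => hτ ?_⟩⟩
    exact Finset.eq_univ_iff_forall.2 fun x => hρ (h ▸ Finset.mem_univ x)

/-- The geometric realization of an abstract simplicial complex, as a subset of the vector space
with one basis vector for each vertex. -/
noncomputable def realization {V : Type*} [DecidableEq V] (K : PreAbstractSimplicialComplex V) :
    Set (V →₀ ℝ) :=
  (Geometry.SimplicialComplex.onFinsupp (𝕜 := ℝ) K).space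

/-- Two finite complexes are PL homeomorphic: there is a bijection of their realizations that is
affine on each of finitely many convex polytopes covering the source. (Such a map is continuous,
being affine on finitely many compact pieces, hence a homeomorphism, and its inverse is piecewise
affine as well.) -/
def PLHomeomorphic {V W : Type*} [DecidableEq V] [DecidableEq W]
    (K : PreAbstractSimplicialComplex V) (M : PreAbstractSimplicialComplex W) : Prop :=
  ∃ f : (V →₀ ℝ) → (W →₀ ℝ), Set.BijOn f (realization K) (realization M) ∧
    ∃ P : Finset (Finset (V →₀ ℝ)),
      realization K = ⋃ S ∈ P, convexHull ℝ (S : Set (V →₀ ℝ)) ∧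
      ∀ S ∈ P, ∃ a : (V →₀ ℝ) →ᵃ[ℝ] (W →₀ ℝ),
        Set.EqOn f a (convexHull ℝ (S : Set (V →₀ ℝ)))

/-- A finite abstract simplicial complex, with vertices in `V`. Not every element of `V` has to be
a vertex of the complex. -/
structure FiniteComplex (V : Type*) extends PreAbstractSimplicialComplex V where
  finite_faces : faces.Finite

/-- `K` is a closed combinatorial `n`-manifold: a finite complex in which the link of every vertex
is PL homeomorphic to `∂Δⁿ`. -/
def FiniteComplex.IsClosedCombinatorialManifold {V : Type*} [DecidableEq V]
    (K : FiniteComplex V) (n : ℕ) : Prop :=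
  ∀ v : V, {v} ∈ K.faces →
    PLHomeomorphic (vertexLink K.toPreAbstractSimplicialComplex v) (simplexBoundary n)

namespace FiniteComplex

variable {V : Type*}

/-- The set `Λ_k` of `k`-simplices. -/
abbrev Simplex (K : FiniteComplex V) (k : ℕ) : Type _ :=
  {σ : Finset V // σ ∈ K.faces ∧ σ.card = k + 1}

instance (K : FiniteComplex V) (k : ℕ) : Finite (K.Simplex k) :=
  (K.finite_faces.subset (fun _ h => h.1 : {σ | σ ∈ K.faces ∧ σ.card = k + 1} ⊆ K.faces)).to_subtype

noncomputable instance (K : FiniteComplex V) (k : ℕ) : Fintype (K.Simplex k) :=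
  Fintype.ofFinite _

/-- If `σ = (i₀ … i_n)` with `i₀ < ⋯ < i_n`, then `K.face σ {a, b, …}` is the face of `σ` with
vertices `i_a, i_b, …`. -/
def face [LinearOrder V] (K : FiniteComplex V) {n m : ℕ} (σ : K.Simplex n)
    (I : Finset (Fin (n + 1))) (hI : I.card = m + 1 := by decide) : K.Simplex m :=
  ⟨I.map (σ.1.orderEmbOfFin σ.2.2).toEmbedding, by
    refine ⟨(K.isRelLowerSet_faces σ.2.1).2 ?_ ?_, by rw [Finset.card_map, hI]⟩
    · intro x hx
      obtain ⟨i, -, rfl⟩ := Finset.mem_map.1 hx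
      exact Finset.orderEmbOfFin_mem σ.1 σ.2.2 i
    · rw [Finset.map_nonempty, ← Finset.card_pos, hI]
      exact Nat.succ_pos m⟩

/-- An orientation of a 4-dimensional complex: each 4-simplex gets a sign relative to the order of
its vertices, and two distinct 4-simplices with a common tetrahedron (opposite to the `i`-th vertex
of the first and to the `j`-th vertex of the second) induce opposite orientations on it. -/
structure Orientation [LinearOrder V] (K : FiniteComplex V) where
  /-- the sign of a 4-simplex -/
  sign : K.Simplex 4 → ℤˣ
  induced_opposite : ∀ (σ τ : K.Simplex 4) (i j : Fin 5), σ ≠ τ →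
    σ.1.erase (σ.1.orderEmbOfFin σ.2.2 i) = τ.1.erase (τ.1.orderEmbOfFin τ.2.2 j) →
    sign σ * (-1) ^ (i : ℕ) = -(sign τ * (-1) ^ (j : ℕ))

/-- `K'` arises from `K` by a Pachner (bistellar) move `p ↔ q` in dimension `p + q - 2`.
There are sets of vertices `A` and `B`, with `q` and `p` elements, such that `A` is a simplex of `K`
whose link is `∂B`, while `B` is not a simplex of `K`; the subcomplex `A * ∂B`, which has `p` simplices
of top dimension, is replaced by `∂A * B`, which has `q` of them. (If `p = 1` then `B` is a new
vertex; if `q = 1` then `A` is a vertex that is removed.) -/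
def IsPachnerMove [DecidableEq V] (p q : ℕ) (K K' : FiniteComplex V) : Prop :=
  ∃ A B : Finset V, A.card = q ∧ B.card = p ∧
    (∀ τ : Finset V, (Disjoint A τ ∧ A ∪ τ ∈ K.faces) ↔ τ ⊂ B) ∧
    B ∉ K.faces ∧
    ∀ σ : Finset V, σ ∈ K'.faces ↔ (σ ∈ K.faces ∧ ¬ A ⊆ σ) ∨ ∃ C, C ⊂ A ∧ σ = C ∪ B

end FiniteComplex

/-! ### The state sum -/

open Classical in
/-- The delta function of a finite group: `δ_X(x) = |X|` if `x = 1`, and `0` otherwise. -/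
noncomputable def groupDelta {X : Type*} [Group X] [Fintype X] (x : X) : ℝ :=
  if x = 1 then (Fintype.card X : ℝ) else 0

namespace FiniteComplex

variable {V : Type*} [LinearOrder V] (K : FiniteComplex V)
  {G H L : Type*} [Group G] [Group H] [Group L]
  [MulDistribMulAction G H] [MulDistribMulAction G L] (X : TwoCrossedModule G H L)

/-- For a triangle `(jkl)`: `∂(h_jkl) g_kl g_jk g_jl⁻¹`. -/
def triangleHolonomy (g : K.Simplex 1 → G) (h : K.Simplex 2 → H) (t : K.Simplex 2) : G :=
  X.bd (h t) * g (K.face t {1, 2}) * g (K.face t {0, 1}) * (g (K.face t {0, 2}))⁻¹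

/-- For a tetrahedron `(jklm)`: `δ(l_jklm) h_jlm (g_lm ▷ h_jkl) h_klm⁻¹ h_jkm⁻¹`. -/
def tetrahedronHolonomy (g : K.Simplex 1 → G) (h : K.Simplex 2 → H) (l : K.Simplex 3 → L)
    (t : K.Simplex 3) : H :=
  X.dl (l t) * h (K.face t {0, 2, 3}) * (g (K.face t {2, 3}) • h (K.face t {0, 1, 2})) *
    (h (K.face t {1, 2, 3}))⁻¹ * (h (K.face t {0, 1, 3}))⁻¹

/-- For a 4-simplex `(jklmn)`:
`l_jlmn⁻¹ (h_jln ▷' {h_lmn, (g_mn g_lm) ▷ h_jkl}) l_jkln⁻¹ (h_jkn ▷' l_klmn) l_jkmn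
(h_jmn ▷' (g_mn ▷ l_jklm))`. -/
def fourSimplexHolonomy (g : K.Simplex 1 → G) (h : K.Simplex 2 → H) (l : K.Simplex 3 → L)
    (s : K.Simplex 4) : L :=
  (l (K.face s {0, 2, 3, 4}))⁻¹ *
    X.act (h (K.face s {0, 2, 4}))
      (X.lift (h (K.face s {2, 3, 4}))
        ((g (K.face s {3, 4}) * g (K.face s {2, 3})) • h (K.face s {0, 1, 2}))) *
    (l (K.face s {0, 1, 2, 4}))⁻¹ *
    X.act (h (K.face s {0, 1, 4})) (l (K.face s {1, 2, 3, 4})) *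
    l (K.face s {0, 1, 3, 4}) *
    X.act (h (K.face s {0, 3, 4})) (g (K.face s {3, 4}) • l (K.face s {0, 1, 2, 3}))

/-- The number of `k`-simplices, as an integer. -/
noncomputable def numSimplices (k : ℕ) : ℤ := (Fintype.card (K.Simplex k) : ℤ)

/-- The state sum. Here `𝔼 g : K.Simplex 1 → G, …` is the average over all labelings of the edges
by elements of `G`, which is the iterated normalized sum `∏_{edges} (1/|G|) ∑_{g ∈ G}`; likewise for
the triangles and the tetrahedra. -/
noncomputable def stateSum [Fintype G] [Fintype H] [Fintype L] : ℝ :=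
  (Fintype.card G : ℝ) ^ (-K.numSimplices 0 + K.numSimplices 1 - K.numSimplices 2) *
  (Fintype.card H : ℝ) ^
    (K.numSimplices 0 - K.numSimplices 1 + K.numSimplices 2 - K.numSimplices 3) *
  (Fintype.card L : ℝ) ^
    (-K.numSimplices 0 + K.numSimplices 1 - K.numSimplices 2 + K.numSimplices 3
      - K.numSimplices 4) *
  𝔼 g : K.Simplex 1 → G, 𝔼 h : K.Simplex 2 → H, 𝔼 l : K.Simplex 3 → L,
    (∏ t : K.Simplex 2, groupDelta (K.triangleHolonomy X g h t)) *
    (∏ t : K.Simplex 3, groupDelta (K.tetrahedronHolonomy X g h l t)) *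
    (∏ s : K.Simplex 4, groupDelta (K.fourSimplexHolonomy X g h l s))

end FiniteComplex

/-! Each delta function is the group order times the indicator of flatness. Expanding all of them,
the powers of `|G|`, `|H|`, `|L|` combine so that, with `n_k` the number of simplices having `k`
vertices, `Z(K)` equals `|G|^(-n_1) |H|^(n_1 - n_2) |L|^(-n_1 + n_2 - n_3)` times the number of flat
labellings (`stateSum_eq_partition`). This quantity makes sense for any finite set of simplices, and
it is invariant under filling a horn, that is, adding a simplex `σ` together with its one missing
facet `τ` (`partition_insert`). Indeed the label of `σ` may be chosen freely; flatness of `σ` then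
determines the label of `τ` uniquely; and flatness of `τ` follows from that of the other faces. The
one new factor, the number of labels of `σ`, is absorbed by the normalization.

A Pachner move replaces one part of the boundary of the 5-simplex `A ∪ B` by the complementary part.
Adding this whole 5-simplex to `K` or to `K'` gives the same set of simplices
(`simplices_union_eq`), and from either side it is added by horn fillings alone (`partition_join`).
Hence both state sums equal the normalized count for the common enlargement.

The algebraic core is the last property of `τ`. If `σ` is a tetrahedron or a 4-simplex, it follows
by applying `∂` or `δ` to the flatness equation of `σ`. If `σ` is a 5-simplex, it is a cocycle
identity (`fourHol_of_fourHol`). There each of the six 4-simplices is a hexagon in a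
three-dimensional permutohedron; the other two hexagons are the product rules of the Peiffer
lifting, and the six squares express that `L → H` is a crossed module under `▷'`. Thus the surface
closes up and any five of the six hexagons imply the sixth (`permutohedron_commutes`).

To treat all dimensions uniformly, a labelling assigns to every finite set of vertices an element of
`G × H × L` whose irrelevant components are `1`. -/

namespace TwoCrossedModule

/-! ### The action `▷'` of `H` on `L` and the product rules of the Peiffer lifting -/

variable {G H L : Type*} [Group G] [Group H] [Group L]
  [MulDistribMulAction G H] [MulDistribMulAction G L] (X : TwoCrossedModule G H L)

theorem lift_one_left (h : H) : X.lift 1 h = 1 := by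
  have := X.lift_mul_left 1 1 h
  simpa using this

theorem lift_one_right (h : H) : X.lift h 1 = 1 := by
  have := X.lift_mul_right h 1 1
  simpa [lift_one_left] using this

theorem lift_dl_left (l : L) (h : H) : X.lift (X.dl l) h = l * X.act h l⁻¹ := by
  simp [act]

/-- The `∂`-twist in `δ{δ(l)⁻¹, h}` disappears because `∂δ = 1`. Together with `act_dl`, this is
what makes `δ` a crossed module once `▷'` is known to be an action by automorphisms. -/
theorem dl_act (h : H) (l : L) : X.dl (X.act h l) = h * X.dl l * h⁻¹ := by
  simp [act, dl_lift, X.bd_dl, mul_assoc]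

theorem act_dl (m l : L) : X.act (X.dl m) l = m * l * m⁻¹ := by
  have := X.lift_dl_dl l⁻¹ m
  rw [act, ← map_inv, ← this]
  group

theorem act_one_left (l : L) : X.act 1 l = l := by
  simp [act, lift_one_right]

theorem act_one_right (h : H) : X.act h 1 = 1 := by
  simp [act, lift_one_left]

/-- Since `⟨h₁, h₃⟩ = δ{h₁, h₃}`, the last two factors of the product axiom are `▷'` by definition.
-/
theorem lift_mul_right_act (h₁ h₂ h₃ : H) :
    X.lift h₁ (h₂ * h₃) = X.lift h₁ h₂ * X.act (X.bd h₁ • h₂) (X.lift h₁ h₃) := by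
  rw [lift_mul_right, act, dl_lift, mul_assoc]

theorem act_mul_left_aux (h₂ h₃ : H) (l : L) :
    X.act (h₂ * h₃) l = X.act h₂ l * X.act h₂ (l⁻¹ * X.act h₃ l) := by
  have := X.lift_mul_right_act (X.dl l)⁻¹ h₂ h₃
  simp only [act] at this ⊢
  rw [this]
  simp [X.bd_dl, mul_assoc]

/-- The product rule in the left argument makes the conjugate of `h` by `δ(a)⁻¹` act on `b`, and
`act_mul_left_aux` unfolds this. The resulting rule still has the factors reversed and a commutator
in the middle; for `b = a⁻¹` the commutator is trivial, which is enough for `act_inv`. -/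
theorem act_mul_right_aux (h : H) (a b : L) :
    X.act h (a * b) = X.act h b * X.act h (b⁻¹ * a * b * a⁻¹) * X.act h a := by
  have e₁ : X.act h (a * b) =
      a * X.act ((X.dl a)⁻¹ * h * X.dl a) b * a⁻¹ * X.act h a := by
    simp only [act, map_mul, mul_inv_rev, lift_mul_left]
    simp [X.bd_dl, mul_assoc]
  have e₂ : (X.dl a)⁻¹ * h * X.dl a = X.dl a⁻¹ * (h * X.dl a) := by simp [mul_assoc]
  rw [e₁, e₂, act_mul_left_aux, act_dl, act_dl, act_mul_left_aux, act_dl]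
  simp [mul_assoc]

theorem act_inv (h : H) (l : L) : X.act h l⁻¹ = (X.act h l)⁻¹ := by
  have := X.act_mul_right_aux h l⁻¹ l
  simp [act_one_right] at this
  exact eq_inv_of_mul_eq_one_right this.symm

theorem lift_dl_right (h : H) (l : L) :
    X.lift h (X.dl l) = X.act h l * (X.bd h • l)⁻¹ := by
  have := X.lift_dl_mul_lift_dl h l
  rw [lift_dl_left, act_inv, mul_assoc, mul_left_cancel_iff, inv_mul_eq_iff_eq_mul] at this
  rw [this, smul_inv']

/-- `H` acts on `L` by automorphisms. -/
theorem act_mul_right (h : H) (a b : L) : X.act h (a * b) = X.act h a * X.act h b := by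
  -- Multiplicativity comes from expanding `{h, δ(ab)}` in two ways.
  have h₁ := X.lift_dl_right h (a * b)
  have h₂ := X.lift_mul_right_act h (X.dl a) (X.dl b)
  rw [← map_mul, h₁, ← X.dl_smul, act_dl, lift_dl_right, lift_dl_right] at h₂
  simp only [smul_mul', mul_inv_rev, mul_assoc, inv_mul_cancel_left] at h₂
  simpa [← mul_assoc] using h₂

theorem act_act (h₁ h₂ : H) (l : L) : X.act h₁ (X.act h₂ l) = X.act (h₁ * h₂) l := by
  rw [act_mul_left_aux, act_mul_right, act_inv]
  simp

theorem act_injective (h : H) : Function.Injective (X.act h) := fun a b hab => by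
  have := congrArg (X.act h⁻¹) hab
  simpa [act_act, act_one_left] using this

theorem smul_act (g : G) (h : H) (l : L) : g • X.act h l = X.act (g • h) (g • l) := by
  simp [act, smul_mul', X.lift_smul, X.dl_smul]

/-- Conjugation by `h₂` differs from `∂(h₂) ▷` by the factor `δ{h₂, h₃}`, which the right product
rule splits off. -/
theorem lift_mul_left_act (h₁ h₂ h₃ : H) :
    X.lift (h₁ * h₂) h₃ = X.act h₁ (X.lift h₂ h₃) * X.lift h₁ (X.bd h₂ • h₃) := by
  have : h₂ * h₃ * h₂⁻¹ = X.dl (X.lift h₂ h₃) * X.bd h₂ • h₃ := by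
    simp [dl_lift, mul_assoc]
  rw [lift_mul_left, this, lift_mul_right_act, lift_dl_right, ← X.dl_smul, act_dl]
  simp [mul_assoc]

/-- If `δ(l) P = Q` then `{Q, x} = l {P, x} ((∂P ▷ x) ▷' l)⁻¹`. -/
theorem lift_dl_mul_left (l : L) (P x : H) :
    X.lift (X.dl l * P) x = l * X.lift P x * (X.act (X.bd P • x) l)⁻¹ := by
  rw [lift_mul_left_act, act_dl, lift_dl_left, act_inv]
  simp [mul_assoc]

theorem lift_dl_mul_right (l : L) (h P : H) :
    X.lift h (X.dl l * P) = X.act h l * X.lift h P * (X.bd h • l)⁻¹ := by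
  rw [lift_mul_right_act, lift_dl_right, ← X.dl_smul, act_dl]
  simp [mul_assoc]

/-- Whiskering: `l (P ▷' m) = (δ(l) P ▷' m) l`. -/
theorem act_dl_mul (l m : L) (P : H) :
    X.act (X.dl l * P) m = l * X.act P m * l⁻¹ := by
  rw [← act_act, act_dl]

end TwoCrossedModule

/-! ### Hexagons and the cocycle identity of the 5-simplex -/

/-- The two-dimensional faces of the three-dimensional permutohedron: six squares and eight
hexagons, with edges labelled in a group. If the squares and two of the hexagons commute, then
each of the other six hexagons commutes as soon as the remaining five do. -/
theorem permutohedron_commutes {L : Type*} [Group L]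
    {p12 p13 p14 p23 p24 p34 a12 a13 a14 a23 a24 a34 b12 b13 b14 b23 b24 b34
      m12 m13 m14 m21 m23 m24 m31 m32 m34 m41 m42 m43 : L}
    (s12 : b12 = p12 * a12 * p12⁻¹) (s13 : b13 = p13 * a13 * p13⁻¹)
    (s14 : b14 = p14 * a14 * p14⁻¹) (s23 : b23 = p23 * a23 * p23⁻¹)
    (s24 : b24 = p24 * a24 * p24⁻¹) (s34 : b34 = p34 * a34 * p34⁻¹)
    (f2 : a12 * m32 * b24 = m42 * b23 * m12) (f3 : a13 * m23 * b34 = m43 * a23 * m13)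
    {w : Fin 6 → Prop}
    (w0 : w 0 ↔ b12 * m31 * b14 = m41 * b13 * m21)
    (w1 : w 1 ↔ m12 * p24 * m14 = p23 * m13 * p34)
    (w2 : w 2 ↔ m21 * p14 * m24 = p13 * m23 * p34)
    (w3 : w 3 ↔ m31 * p14 * m34 = p12 * m32 * p24)
    (w4 : w 4 ↔ m41 * p13 * m43 = p12 * m42 * p23)
    (w5 : w 5 ↔ a14 * m24 * a34 = m34 * a24 * m14)
    (v : Fin 6) (hv : ∀ u, u ≠ v → w u) : w v := by
  subst s12 s13 s14 s23 s24 s34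
  -- The two hexagons that always commute eliminate `a12` and `a13`. Each of the hexagons 1 to 5
  -- likewise eliminates one edge; after all these substitutions hexagon 0 is an identity in the
  -- free group.
  have e2 : a12 = m42 * p23 * a23 * p23⁻¹ * m12 * (m32 * p24 * a24 * p24⁻¹)⁻¹ :=
    eq_mul_inv_of_mul_eq (by simpa [mul_assoc] using f2)
  have e3 : a13 = m43 * a23 * m13 * (m23 * p34 * a34 * p34⁻¹)⁻¹ :=
    eq_mul_inv_of_mul_eq (by simpa [mul_assoc] using f3)
  subst e2 e3
  clear f2 f3
  have e1 : w 1 → m12 = p23 * m13 * p34 * (p24 * m14)⁻¹ := fun h =>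
    eq_mul_inv_of_mul_eq (by simpa [mul_assoc] using w1.1 h)
  have e2 : w 2 → m21 = p13 * m23 * p34 * (p14 * m24)⁻¹ := fun h =>
    eq_mul_inv_of_mul_eq (by simpa [mul_assoc] using w2.1 h)
  have e3 : w 3 → m31 = p12 * m32 * p24 * (p14 * m34)⁻¹ := fun h =>
    eq_mul_inv_of_mul_eq (by simpa [mul_assoc] using w3.1 h)
  have e4 : w 4 → m41 = p12 * m42 * p23 * (p13 * m43)⁻¹ := fun h =>
    eq_mul_inv_of_mul_eq (by simpa [mul_assoc] using w4.1 h)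
  have e5 : w 5 → a14 = m34 * a24 * m14 * (m24 * a34)⁻¹ := fun h =>
    eq_mul_inv_of_mul_eq (by simpa [mul_assoc] using w5.1 h)
  fin_cases v
  · have := e1 (hv 1 (by decide)); have := e2 (hv 2 (by decide)); have := e3 (hv 3 (by decide))
    have := e4 (hv 4 (by decide)); have := e5 (hv 5 (by decide))
    subst m12 m21 m31 m41 a14
    exact w0.2 (by group)
  · have h := w0.1 (hv 0 (by decide))
    have := e2 (hv 2 (by decide)); have := e3 (hv 3 (by decide)); have := e4 (hv 4 (by decide))
    have := e5 (hv 5 (by decide))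
    subst m21 m31 m41 a14
    -- With hexagon `v` not solved, hexagon 0 becomes that hexagon up to left factors and a common
    -- tail on the right. The multiplier cancels the tail; the other cases use the same device.
    have h' := congrArg (fun z => z * (p14 * m24 * a34)) h
    exact w1.2 (by simpa [mul_assoc, inv_mul_eq_iff_eq_mul] using h')
  · have h := w0.1 (hv 0 (by decide))
    have := e1 (hv 1 (by decide)); have := e3 (hv 3 (by decide)); have := e4 (hv 4 (by decide))
    have := e5 (hv 5 (by decide))
    subst m12 m31 m41 a14
    have h' := congrArg (fun z => z * (p14 * m24)) h
    exact w2.2 (by simpa [mul_assoc, inv_mul_eq_iff_eq_mul] using h'.symm)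
  · have h := w0.1 (hv 0 (by decide))
    have := e1 (hv 1 (by decide)); have := e2 (hv 2 (by decide)); have := e4 (hv 4 (by decide))
    have := e5 (hv 5 (by decide))
    subst m12 m21 m41 a14
    have h' := congrArg (fun z => z * (p14 * m24 * a34 * m14⁻¹ * a24⁻¹)) h
    exact w3.2 (by simpa [mul_assoc, inv_mul_eq_iff_eq_mul] using h')
  · have h := w0.1 (hv 0 (by decide))
    have := e1 (hv 1 (by decide)); have := e2 (hv 2 (by decide)); have := e3 (hv 3 (by decide))
    have := e5 (hv 5 (by decide))
    subst m12 m21 m31 a14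
    have h' := congrArg (fun z => z * ((a23 * m13 * p34 * a34⁻¹ * m24⁻¹ * p14⁻¹)⁻¹)) h
    exact w4.2 (by simpa [mul_assoc, inv_mul_eq_iff_eq_mul] using h'.symm)
  · have h := w0.1 (hv 0 (by decide))
    have := e1 (hv 1 (by decide)); have := e2 (hv 2 (by decide)); have := e3 (hv 3 (by decide))
    have := e4 (hv 4 (by decide))
    subst m12 m21 m31 m41
    have h' := congrArg (fun z => z * (p14 * m24 * a34)) h
    exact w5.2 (by simpa [mul_assoc, inv_mul_eq_iff_eq_mul] using h')

namespace TwoCrossedModule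

variable {G H L : Type*} [Group G] [Group H] [Group L]
  [MulDistribMulAction G H] [MulDistribMulAction G L] (X : TwoCrossedModule G H L)

section Holonomy

variable {V : Type*} (g : V → V → G) (h : V → V → V → H) (l : V → V → V → V → L)

/-- The holonomy of the triangle `(abc)`. -/
def triHol (a b c : V) : G := X.bd (h a b c) * g b c * g a b * (g a c)⁻¹

/-- The holonomy of the tetrahedron `(abcd)`. -/
def tetHol (a b c d : V) : H :=
  X.dl (l a b c d) * h a c d * (g c d • h a b c) * (h b c d)⁻¹ * (h a b d)⁻¹

/-- The holonomy of the 4-simplex `(abcde)`. -/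
def fourHol (a b c d e : V) : L :=
  (l a c d e)⁻¹ * X.act (h a c e) (X.lift (h c d e) ((g d e * g c d) • h a b c)) *
    (l a b c e)⁻¹ * X.act (h a b e) (l b c d e) * l a b d e *
    X.act (h a d e) (g d e • l a b c d)

variable {g h l}

theorem bd_of_triHol {a b c : V} (t : X.triHol g h a b c = 1) :
    X.bd (h a b c) * g b c * g a b = g a c := by
  rwa [triHol, mul_inv_eq_one] at t

theorem dl_of_tetHol {a b c d : V} (t : X.tetHol g h l a b c d = 1) :
    X.dl (l a b c d) * (h a c d * g c d • h a b c) = h a b d * h b c d := by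
  rw [tetHol, mul_inv_eq_one, mul_inv_eq_iff_eq_mul] at t
  rw [← t, mul_assoc]

/-- The hexagon form of flatness, with three edges on each side. Five edges are tetrahedra and the
sixth is a Peiffer lifting, the interchange of the two outer triangles. -/
theorem fourHol_eq_one_iff {a b c d e : V} : X.fourHol g h l a b c d e = 1 ↔
    X.act (h a b e) (l b c d e) * l a b d e * X.act (h a d e) (g d e • l a b c d) =
      l a b c e * X.act (h a c e) (X.lift (h c d e) ((g d e * g c d) • h a b c))⁻¹ *
        l a c d e := by
  rw [fourHol, act_inv]
  simp only [mul_assoc, inv_mul_eq_one]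
  rw [eq_comm, ← eq_inv_mul_iff_mul_eq, inv_mul_eq_iff_eq_mul]

end Holonomy

/-- If all the triangles and tetrahedra of a 5-simplex are flat, and five of its 4-dimensional
faces are flat, then so is the sixth. -/
theorem fourHol_of_fourHol {g : Fin 6 → Fin 6 → G} {h : Fin 6 → Fin 6 → Fin 6 → H}
    {l : Fin 6 → Fin 6 → Fin 6 → Fin 6 → L}
    (ht : ∀ a b c, a < b → b < c → X.triHol g h a b c = 1)
    (hT : ∀ a b c d, a < b → b < c → c < d → X.tetHol g h l a b c d = 1) (v : Fin 6)
    (hv : ∀ u : Fin 6, u ≠ v → X.fourHol g h l (u.succAbove 0) (u.succAbove 1) (u.succAbove 2)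
      (u.succAbove 3) (u.succAbove 4) = 1) :
    X.fourHol g h l (v.succAbove 0) (v.succAbove 1) (v.succAbove 2)
      (v.succAbove 3) (v.succAbove 4) = 1 := by
  -- The squares: flatness of `(0cd5)` and the Peiffer identity of `L → H` turn whiskering into
  -- conjugation by `l 0 c d 5`.
  have sq (c d : Fin 6) (hc : 0 < c) (hd : c < d) (h5 : d < 5) (m : L) :
      X.act (h 0 c 5 * h c d 5) m =
        l 0 c d 5 * X.act (h 0 d 5 * g d 5 • h 0 c d) m * (l 0 c d 5)⁻¹ := by
    rw [← X.act_dl_mul, X.dl_of_tetHol (hT 0 c d 5 hc hd h5)]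
  refine permutohedron_commutes (w := fun u => X.fourHol g h l (u.succAbove 0) (u.succAbove 1)
      (u.succAbove 2) (u.succAbove 3) (u.succAbove 4) = 1)
    (m12 := X.act (h 0 2 5) (l 2 3 4 5)) (m14 := X.act (h 0 4 5) (g 4 5 • l 0 2 3 4))
    (m13 := X.act (h 0 3 5) (X.lift (h 3 4 5) ((g 4 5 * g 3 4) • h 0 2 3))⁻¹)
    (m21 := X.act (h 0 1 5) (l 1 3 4 5)) (m24 := X.act (h 0 4 5) (g 4 5 • l 0 1 3 4))
    (m23 := X.act (h 0 3 5) (X.lift (h 3 4 5) ((g 4 5 * g 3 4) • h 0 1 3))⁻¹)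
    (m31 := X.act (h 0 1 5) (l 1 2 4 5)) (m34 := X.act (h 0 4 5) (g 4 5 • l 0 1 2 4))
    (m32 := X.act (h 0 2 5) (X.lift (h 2 4 5) ((g 4 5 * g 2 4) • h 0 1 2))⁻¹)
    (m41 := X.act (h 0 1 5) (l 1 2 3 5)) (m43 := X.act (h 0 3 5) (g 3 5 • l 0 1 2 3))
    (m42 := X.act (h 0 2 5) (X.lift (h 2 3 5) ((g 3 5 * g 2 3) • h 0 1 2))⁻¹)
    (sq 1 2 (by decide) (by decide) (by decide) (l 2 3 4 5))
    (sq 1 3 (by decide) (by decide) (by decide)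
      (X.lift (h 3 4 5) ((g 4 5 * g 3 4) • h 1 2 3))⁻¹)
    (sq 1 4 (by decide) (by decide) (by decide) (g 4 5 • l 1 2 3 4))
    (sq 2 3 (by decide) (by decide) (by decide)
      (X.lift (h 3 4 5) ((g 4 5 * g 3 4 * g 2 3) • h 0 1 2))⁻¹)
    (sq 2 4 (by decide) (by decide) (by decide)
      (X.lift (g 4 5 • h 2 3 4) ((g 4 5 * g 3 4 * g 2 3) • h 0 1 2))⁻¹)
    (sq 3 4 (by decide) (by decide) (by decide) ((g 4 5 * g 3 4) • l 0 1 2 3))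
    ?_ ?_ ?_ ?_ ?_ ?_ ?_ ?_ v hv
  -- First automatic hexagon: the flatness equation of `(2345)` is paired with the transported `h 0
  -- 1 2` in the right argument, and both sides are expanded by the left product rule.
  · have t := X.dl_of_tetHol (hT 2 3 4 5 (by decide) (by decide) (by decide))
    have t₁ := X.lift_dl_mul_left (l 2 3 4 5) (h 2 4 5 * g 4 5 • h 2 3 4)
      ((g 4 5 * g 3 4 * g 2 3) • h 0 1 2)
    have b₁ := X.bd_of_triHol (ht 2 3 4 (by decide) (by decide))
    have b₂ := X.bd_of_triHol (ht 2 4 5 (by decide) (by decide))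
    have b₃ := X.bd_of_triHol (ht 3 4 5 (by decide) (by decide))
    have c₁ : X.bd (g 4 5 • h 2 3 4) * (g 4 5 * g 3 4 * g 2 3) = g 4 5 * g 2 4 := by
      rw [X.bd_smul, ← b₁]; group
    have c₂ : X.bd (h 2 4 5 * g 4 5 • h 2 3 4) * (g 4 5 * g 3 4 * g 2 3) = g 2 5 := by
      rw [map_mul, mul_assoc, c₁, ← b₂, mul_assoc]
    have c₃ : X.bd (h 3 4 5) * (g 4 5 * g 3 4 * g 2 3) = g 3 5 * g 2 3 := by
      rw [← b₃]; group
    rw [t, lift_mul_left_act, lift_mul_left_act, ← mul_smul, ← mul_smul, ← mul_smul, c₁, c₂,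
      c₃] at t₁
    simp only [← X.act_act (h 0 2 5), ← X.act_mul_right]
    congr 1
    simp only [act_inv]
    have t₂ := congrArg (·⁻¹) t₁
    simp only [mul_inv_rev, inv_inv] at t₂
    rw [t₂]
    group
  -- Second automatic hexagon: `h 3 4 5` is paired with the transported flatness equation of
  -- `(0123)`, expanded by the right product rule.
  · have t := X.dl_of_tetHol (hT 0 1 2 3 (by decide) (by decide) (by decide))
    have b := X.bd_of_triHol (ht 3 4 5 (by decide) (by decide))
    have t₁ := X.lift_dl_mul_right ((g 4 5 * g 3 4) • l 0 1 2 3) (h 3 4 5)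
      ((g 4 5 * g 3 4) • (h 0 2 3 * g 2 3 • h 0 1 2))
    rw [X.dl_smul, ← smul_mul', t, smul_mul', smul_mul', lift_mul_right_act, lift_mul_right_act]
      at t₁
    simp only [← mul_smul, ← mul_assoc, b] at t₁
    simp only [← X.act_act (h 0 3 5), ← X.act_mul_right]
    congr 1
    simp only [act_inv]
    have t₂ := congrArg (·⁻¹) t₁
    simp only [mul_inv_rev, inv_inv] at t₂
    rw [t₂]
    group
  -- The faces opposite to `0` and `5` occur whiskered, by `h 0 1 5` here and by `g 4 5` and `h 0 4
  -- 5` for the last one; injectivity of these actions makes whiskering harmless.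
  · refine X.fourHol_eq_one_iff.trans ((X.act_injective (h 0 1 5)).eq_iff.symm.trans ?_)
    simp only [act_mul_right, act_act]
    exact Iff.rfl
  · exact X.fourHol_eq_one_iff
  · exact X.fourHol_eq_one_iff
  · exact X.fourHol_eq_one_iff
  · exact X.fourHol_eq_one_iff
  · refine X.fourHol_eq_one_iff.trans ((MulAction.injective (g 4 5)).eq_iff.symm.trans
      ((X.act_injective (h 0 4 5)).eq_iff.symm.trans ?_))
    simp only [smul_mul', smul_act, act_mul_right, act_act, smul_inv', X.lift_smul, ← mul_smul,
      ← mul_assoc]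
    exact Iff.rfl

end TwoCrossedModule

/-- In each flatness equation the label of a given facet occurs exactly once, possibly inverted or
acted upon, so the equation has this shape. -/
theorem existsUnique_mul_mul_eq_one {Y Z : Type*} [Group Z] {f : Y → Z}
    (hf : Function.Bijective f) (A B : Z) : ∃! y, A * f y * B = 1 := by
  obtain ⟨y, hy⟩ := hf.2 (A⁻¹ * B⁻¹)
  refine ⟨y, by simp [hy], fun z hz => hf.1 ?_⟩
  rw [hy, eq_inv_mul_iff_mul_eq, ← mul_eq_one_iff_eq_inv, hz]

/-! ### Flatness of the last face of a tetrahedron or a 4-simplex -/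

namespace TwoCrossedModule

variable {G H L : Type*} [Group G] [Group H] [Group L]
  [MulDistribMulAction G H] [MulDistribMulAction G L] (X : TwoCrossedModule G H L)

theorem act_bijective (h : H) : Function.Bijective (X.act h) :=
  ⟨X.act_injective h, fun l => ⟨X.act h⁻¹ l, by simp [act_act, act_one_left]⟩⟩

/-- If a tetrahedron and three of its faces are flat, then so is the fourth. -/
theorem triHol_of_tetHol {g : Fin 4 → Fin 4 → G} {h : Fin 4 → Fin 4 → Fin 4 → H}
    {l : Fin 4 → Fin 4 → Fin 4 → Fin 4 → L} (hT : X.tetHol g h l 0 1 2 3 = 1) (v : Fin 4)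
    (hv : ∀ u : Fin 4, u ≠ v →
      X.triHol g h (u.succAbove 0) (u.succAbove 1) (u.succAbove 2) = 1) :
    X.triHol g h (v.succAbove 0) (v.succAbove 1) (v.succAbove 2) = 1 := by
  -- Applying `∂` removes `l`, leaving a relation among the four triangle holonomies in which three
  -- are trivial.
  have key := congrArg X.bd (X.dl_of_tetHol hT)
  simp only [map_mul, X.bd_dl, one_mul, X.bd_smul] at key
  have e (a b c : Fin 4) : X.bd (h a b c) =
      X.triHol g h a b c * (g a c * (g a b)⁻¹ * (g b c)⁻¹) := by
    simp [triHol, mul_assoc]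
  rw [e, e, e, e] at key
  have h0 : (0 : Fin 4) ≠ v → X.triHol g h 1 2 3 = 1 := hv 0
  have h1 : (1 : Fin 4) ≠ v → X.triHol g h 0 2 3 = 1 := hv 1
  have h2 : (2 : Fin 4) ≠ v → X.triHol g h 0 1 3 = 1 := hv 2
  have h3 : (3 : Fin 4) ≠ v → X.triHol g h 0 1 2 = 1 := hv 3
  fin_cases v
  · rw [h1 (by decide), h2 (by decide), h3 (by decide)] at key
    change X.triHol g h 1 2 3 = 1
    simpa [mul_assoc, inv_mul_eq_iff_eq_mul, eq_inv_mul_iff_mul_eq] using key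
  · rw [h0 (by decide), h2 (by decide), h3 (by decide)] at key
    change X.triHol g h 0 2 3 = 1
    simpa [mul_assoc, inv_mul_eq_iff_eq_mul, eq_inv_mul_iff_mul_eq] using key
  · rw [h0 (by decide), h1 (by decide), h3 (by decide)] at key
    change X.triHol g h 0 1 3 = 1
    simpa [mul_assoc, inv_mul_eq_iff_eq_mul, eq_inv_mul_iff_mul_eq] using key
  · rw [h0 (by decide), h1 (by decide), h2 (by decide)] at key
    change X.triHol g h 0 1 2 = 1
    have key' := congrArg (fun z => z * (g 2 3 * g 1 2 * g 0 1)) key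
    simpa [mul_assoc, inv_mul_eq_iff_eq_mul, eq_inv_mul_iff_mul_eq] using key'

/-- If a 4-simplex, its triangles, and four of its tetrahedra are flat, then so is the fifth
tetrahedron. -/
theorem tetHol_of_fourHol {g : Fin 5 → Fin 5 → G} {h : Fin 5 → Fin 5 → Fin 5 → H}
    {l : Fin 5 → Fin 5 → Fin 5 → Fin 5 → L}
    (ht : ∀ a b c, a < b → b < c → X.triHol g h a b c = 1)
    (hF : X.fourHol g h l 0 1 2 3 4 = 1) (v : Fin 5)
    (hv : ∀ u : Fin 5, u ≠ v → X.tetHol g h l (u.succAbove 0) (u.succAbove 1) (u.succAbove 2)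
      (u.succAbove 3) = 1) :
    X.tetHol g h l (v.succAbove 0) (v.succAbove 1) (v.succAbove 2) (v.succAbove 3) = 1 := by
  have b := X.bd_of_triHol (ht 2 3 4 (by decide) (by decide))
  -- Applying `δ` to the hexagon leaves a relation among the five tetrahedron holonomies; flatness
  -- of `(234)` identifies the two transports of `h 0 1 2`.
  have key := congrArg X.dl (X.fourHol_eq_one_iff.1 hF)
  simp only [map_mul, map_inv, X.dl_act, X.dl_smul, X.dl_lift, ← mul_smul, smul_inv', ← mul_assoc,
    b] at key
  have e (a b c d : Fin 5) : X.dl (l a b c d) =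
      X.tetHol g h l a b c d * (h a b d * h b c d * (g c d • h a b c)⁻¹ * (h a c d)⁻¹) := by
    simp [tetHol, mul_assoc]
  rw [e, e, e, e, e] at key
  simp only [smul_mul', smul_inv', ← mul_smul] at key
  have h0 : (0 : Fin 5) ≠ v → X.tetHol g h l 1 2 3 4 = 1 := hv 0
  have h1 : (1 : Fin 5) ≠ v → X.tetHol g h l 0 2 3 4 = 1 := hv 1
  have h2 : (2 : Fin 5) ≠ v → X.tetHol g h l 0 1 3 4 = 1 := hv 2
  have h3 : (3 : Fin 5) ≠ v → X.tetHol g h l 0 1 2 4 = 1 := hv 3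
  have h4 : (4 : Fin 5) ≠ v → X.tetHol g h l 0 1 2 3 = 1 := hv 4
  fin_cases v
  · rw [h1 (by decide), h2 (by decide), h3 (by decide), h4 (by decide)] at key
    change X.tetHol g h l 1 2 3 4 = 1
    simpa [mul_assoc, inv_mul_eq_iff_eq_mul, eq_inv_mul_iff_mul_eq] using key
  · rw [h0 (by decide), h2 (by decide), h3 (by decide), h4 (by decide)] at key
    change X.tetHol g h l 0 2 3 4 = 1
    simpa [mul_assoc, inv_mul_eq_iff_eq_mul, eq_inv_mul_iff_mul_eq] using key
  · rw [h0 (by decide), h1 (by decide), h3 (by decide), h4 (by decide)] at key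
    change X.tetHol g h l 0 1 3 4 = 1
    have key' := congrArg
      (fun z => z * (h 0 3 4 * g 3 4 • h 0 2 3 * (g 3 4 * g 2 3) • h 0 1 2)) key
    simpa [mul_assoc, inv_mul_eq_iff_eq_mul, eq_inv_mul_iff_mul_eq] using key'
  · rw [h0 (by decide), h1 (by decide), h2 (by decide), h4 (by decide)] at key
    change X.tetHol g h l 0 1 2 4 = 1
    simpa [mul_assoc, inv_mul_eq_iff_eq_mul, eq_inv_mul_iff_mul_eq] using key
  · rw [h0 (by decide), h1 (by decide), h2 (by decide), h3 (by decide)] at key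
    change X.tetHol g h l 0 1 2 3 = 1
    have key' := congrArg
      (fun z => z * (h 0 3 4 * g 3 4 • h 0 2 3 * (g 3 4 * g 2 3) • h 0 1 2)) key
    simpa [mul_assoc, inv_mul_eq_iff_eq_mul, smul_eq_iff_eq_inv_smul] using key'

end TwoCrossedModule

/-! ### Labellings of finite sets of vertices and their flatness -/

namespace TwoCrossedModule

section Labels

variable {G H L : Type*} [Group G] [Group H] [Group L]

/-- The labels of a simplex with `n` vertices: an edge has a label in `G`, a triangle one in `H`,
a tetrahedron one in `L`, and the other components are trivial. -/
def labels (G H L : Type*) [Group G] [Group H] [Group L] (n : ℕ) : Set (G × H × L) :=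
  {x | (n ≠ 2 → x.1 = 1) ∧ (n ≠ 3 → x.2.1 = 1) ∧ (n ≠ 4 → x.2.2 = 1)}

theorem mem_labels_trivial {n : ℕ} (h2 : n ≠ 2) (h3 : n ≠ 3) (h4 : n ≠ 4) {x : G × H × L} :
    x ∈ labels G H L n ↔ x = 1 := by
  simp [labels, Prod.ext_iff, h2, h3, h4]

theorem existsUnique_labels_two {p : G × H × L → Prop} (h : ∃! y : G, p (y, 1, 1)) :
    ∃! y, y ∈ labels G H L 2 ∧ p y := by
  obtain ⟨y, hy, hu⟩ := h
  refine ⟨(y, 1, 1), ⟨by simp [labels], hy⟩, ?_⟩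
  rintro ⟨a, b, d⟩ ⟨hz, hp⟩
  obtain ⟨rfl, rfl⟩ : b = 1 ∧ d = 1 := by simpa [labels] using hz
  rw [hu a hp]

theorem existsUnique_labels_three {p : G × H × L → Prop} (h : ∃! y : H, p (1, y, 1)) :
    ∃! y, y ∈ labels G H L 3 ∧ p y := by
  obtain ⟨y, hy, hu⟩ := h
  refine ⟨(1, y, 1), ⟨by simp [labels], hy⟩, ?_⟩
  rintro ⟨a, b, d⟩ ⟨hz, hp⟩
  obtain ⟨rfl, rfl⟩ : a = 1 ∧ d = 1 := by simpa [labels] using hz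
  rw [hu b hp]

theorem existsUnique_labels_four {p : G × H × L → Prop} (h : ∃! y : L, p (1, 1, y)) :
    ∃! y, y ∈ labels G H L 4 ∧ p y := by
  obtain ⟨y, hy, hu⟩ := h
  refine ⟨(1, 1, y), ⟨by simp [labels], hy⟩, ?_⟩
  rintro ⟨a, b, d⟩ ⟨hz, hp⟩
  obtain ⟨rfl, rfl⟩ : a = 1 ∧ b = 1 := by simpa [labels] using hz
  rw [hu d hp]

theorem card_labels_two : Nat.card (labels G H L 2) = Nat.card G :=
  Nat.card_congr ⟨fun x => x.1.1, fun g => ⟨(g, 1, 1), by simp [labels]⟩, fun x => by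
    obtain ⟨⟨a, b, d⟩, h⟩ := x
    obtain ⟨rfl, rfl⟩ : b = 1 ∧ d = 1 := by simpa [labels] using h
    rfl, fun _ => rfl⟩

theorem card_labels_three : Nat.card (labels G H L 3) = Nat.card H :=
  Nat.card_congr ⟨fun x => x.1.2.1, fun g => ⟨(1, g, 1), by simp [labels]⟩, fun x => by
    obtain ⟨⟨a, b, d⟩, h⟩ := x
    obtain ⟨rfl, rfl⟩ : a = 1 ∧ d = 1 := by simpa [labels] using h
    rfl, fun _ => rfl⟩

theorem card_labels_four : Nat.card (labels G H L 4) = Nat.card L :=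
  Nat.card_congr ⟨fun x => x.1.2.2, fun g => ⟨(1, 1, g), by simp [labels]⟩, fun x => by
    obtain ⟨⟨a, b, d⟩, h⟩ := x
    obtain ⟨rfl, rfl⟩ : a = 1 ∧ b = 1 := by simpa [labels] using h
    rfl, fun _ => rfl⟩

theorem card_labels_trivial {n : ℕ} (h2 : n ≠ 2) (h3 : n ≠ 3) (h4 : n ≠ 4) :
    Nat.card (labels G H L n) = 1 := by
  have : labels G H L n = {1} := Set.ext fun x => mem_labels_trivial h2 h3 h4
  rw [this]
  simp

end Labels

variable {G H L : Type*} [Group G] [Group H] [Group L]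
  [MulDistribMulAction G H] [MulDistribMulAction G L] (X : TwoCrossedModule G H L)

section Flat

variable {V : Type*}

/-- The `G`-labels of the edges. -/
def gLabel [DecidableEq V] (c : Finset V → G × H × L) (a b : V) : G := (c {a, b}).1

/-- The `H`-labels of the triangles. -/
def hLabel [DecidableEq V] (c : Finset V → G × H × L) (a b d : V) : H := (c {a, b, d}).2.1

/-- The `L`-labels of the tetrahedra. -/
def lLabel [DecidableEq V] (c : Finset V → G × H × L) (a b d e : V) : L := (c {a, b, d, e}).2.2

variable [LinearOrder V]

/-- The labelling `c` satisfies the flatness condition of the simplex `s`. -/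
def IsFlatAt (c : Finset V → G × H × L) (s : Finset V) : Prop :=
  (∀ hs : s.card = 3, X.triHol (gLabel c) (hLabel c) (s.orderEmbOfFin hs 0)
    (s.orderEmbOfFin hs 1) (s.orderEmbOfFin hs 2) = 1) ∧
  (∀ hs : s.card = 4, X.tetHol (gLabel c) (hLabel c) (lLabel c) (s.orderEmbOfFin hs 0)
    (s.orderEmbOfFin hs 1) (s.orderEmbOfFin hs 2) (s.orderEmbOfFin hs 3) = 1) ∧
  (∀ hs : s.card = 5, X.fourHol (gLabel c) (hLabel c) (lLabel c) (s.orderEmbOfFin hs 0)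
    (s.orderEmbOfFin hs 1) (s.orderEmbOfFin hs 2) (s.orderEmbOfFin hs 3)
    (s.orderEmbOfFin hs 4) = 1)

variable {X} {c : Finset V → G × H × L} {s : Finset V}

theorem isFlatAt_of_card (h3 : s.card ≠ 3) (h4 : s.card ≠ 4) (h5 : s.card ≠ 5) :
    X.IsFlatAt c s :=
  ⟨fun h => (h3 h).elim, fun h => (h4 h).elim, fun h => (h5 h).elim⟩

theorem isFlatAt_triangle {e : Fin 3 → V} (he : StrictMono e) (hs : s = Finset.univ.image e) :
    X.IsFlatAt c s ↔ X.triHol (gLabel c) (hLabel c) (e 0) (e 1) (e 2) = 1 := by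
  have hc : s.card = 3 := by rw [hs, Finset.card_image_of_injective _ he.injective]; rfl
  have := Finset.orderEmbOfFin_unique hc (f := e) (by simp [hs]) he
  subst this
  exact ⟨fun h => h.1 hc, fun h => ⟨fun _ => h, fun h' => absurd (hc.symm.trans h') (by decide),
    fun h' => absurd (hc.symm.trans h') (by decide)⟩⟩

theorem isFlatAt_tetrahedron {e : Fin 4 → V} (he : StrictMono e) (hs : s = Finset.univ.image e) :
    X.IsFlatAt c s ↔
      X.tetHol (gLabel c) (hLabel c) (lLabel c) (e 0) (e 1) (e 2) (e 3) = 1 := by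
  have hc : s.card = 4 := by rw [hs, Finset.card_image_of_injective _ he.injective]; rfl
  have := Finset.orderEmbOfFin_unique hc (f := e) (by simp [hs]) he
  subst this
  exact ⟨fun h => h.2.1 hc, fun h => ⟨fun h' => absurd (hc.symm.trans h') (by decide), fun _ => h,
    fun h' => absurd (hc.symm.trans h') (by decide)⟩⟩

theorem isFlatAt_fourSimplex {e : Fin 5 → V} (he : StrictMono e) (hs : s = Finset.univ.image e) :
    X.IsFlatAt c s ↔
      X.fourHol (gLabel c) (hLabel c) (lLabel c) (e 0) (e 1) (e 2) (e 3) (e 4) = 1 := by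
  have hc : s.card = 5 := by rw [hs, Finset.card_image_of_injective _ he.injective]; rfl
  have := Finset.orderEmbOfFin_unique hc (f := e) (by simp [hs]) he
  subst this
  exact ⟨fun h => h.2.2 hc, fun h => ⟨fun h' => absurd (hc.symm.trans h') (by decide),
    fun h' => absurd (hc.symm.trans h') (by decide), fun _ => h⟩⟩

/-- Flatness at `s` depends only on the labels of the faces of `s`. -/
theorem isFlatAt_congr {c' : Finset V → G × H × L} (h : ∀ r ⊆ s, c r = c' r) :
    X.IsFlatAt c s ↔ X.IsFlatAt c' s := by
  have hg {a b} (ha : a ∈ s) (hb : b ∈ s) : gLabel c a b = gLabel c' a b := by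
    rw [gLabel, h _ (by simp [Finset.insert_subset_iff, *]), gLabel]
  have hh {a b d} (ha : a ∈ s) (hb : b ∈ s) (hd : d ∈ s) :
      hLabel c a b d = hLabel c' a b d := by
    rw [hLabel, h _ (by simp [Finset.insert_subset_iff, *]), hLabel]
  have hl {a b d e} (ha : a ∈ s) (hb : b ∈ s) (hd : d ∈ s) (he : e ∈ s) :
      lLabel c a b d e = lLabel c' a b d e := by
    rw [lLabel, h _ (by simp [Finset.insert_subset_iff, *]), lLabel]
  have hm {n} (hs : s.card = n) (i : Fin n) := s.orderEmbOfFin_mem hs i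
  simp only [IsFlatAt, triHol, tetHol, fourHol, hg, hh, hl, hm]

/-- Flatness is natural with respect to order embeddings of the vertices. -/
theorem isFlatAt_map {W : Type*} [LinearOrder W] (e : W ↪o V) (s : Finset W) :
    X.IsFlatAt (fun r => c (r.map e.toEmbedding)) s ↔ X.IsFlatAt c (s.map e.toEmbedding) := by
  have hg : gLabel (fun r => c (r.map e.toEmbedding)) = fun a b => gLabel c (e a) (e b) := by
    funext a b; simp [gLabel, Finset.map_insert]
  have hh : hLabel (fun r => c (r.map e.toEmbedding)) =
      fun a b d => hLabel c (e a) (e b) (e d) := by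
    funext a b d; simp [hLabel, Finset.map_insert]
  have hl : lLabel (fun r => c (r.map e.toEmbedding)) =
      fun a b d f => lLabel c (e a) (e b) (e d) (e f) := by
    funext a b d f; simp [lLabel, Finset.map_insert]
  have hm {n} (hs : s.card = n) (hs' : (s.map e.toEmbedding).card = n) (i : Fin n) :
      (s.map e.toEmbedding).orderEmbOfFin hs' i = e (s.orderEmbOfFin hs i) := by
    have := Finset.orderEmbOfFin_unique hs' (f := fun i => e (s.orderEmbOfFin hs i))
      (fun i => by simp) (e.strictMono.comp (s.orderEmbOfFin hs).strictMono)
    exact (congrFun this i).symm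
  simp only [IsFlatAt, hg, hh, hl, triHol, tetHol, fourHol]
  refine and_congr ?_ (and_congr ?_ ?_)
  all_goals
    refine ⟨fun h hs => ?_, fun h hs => ?_⟩
    · have hs' := hs
      rw [Finset.card_map] at hs'
      simpa only [hm hs' hs] using h hs'
    · have hs' := hs
      rw [← Finset.card_map e.toEmbedding] at hs'
      simpa only [hm hs hs'] using h hs'

end Flat

section Horn

variable {X}

theorem triHol_of_isFlatAt {n : ℕ} {c : Finset (Fin n) → G × H × L}
    {a b d : Fin n} (hab : a < b) (hbd : b < d) (h : X.IsFlatAt c {a, b, d}) :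
    X.triHol (gLabel c) (hLabel c) a b d = 1 :=
  (isFlatAt_triangle (e := ![a, b, d]) (by
    intro i j hij; fin_cases i <;> fin_cases j <;> simp_all [hab.trans hbd]) (by
    ext x; simp [Fin.exists_fin_succ, eq_comm])).1 h

theorem tetHol_of_isFlatAt {n : ℕ} {c : Finset (Fin n) → G × H × L}
    {a b d e : Fin n} (hab : a < b) (hbd : b < d) (hde : d < e) (h : X.IsFlatAt c {a, b, d, e}) :
    X.tetHol (gLabel c) (hLabel c) (lLabel c) a b d e = 1 :=
  (isFlatAt_tetrahedron (e := ![a, b, d, e]) (by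
    intro i j hij; fin_cases i <;> fin_cases j <;>
      simp_all [hab.trans hbd, hbd.trans hde, hab.trans (hbd.trans hde)]) (by
    ext x; simp [Fin.exists_fin_succ, eq_comm])).1 h

theorem univ_erase_eq_image {n : ℕ} (v : Fin (n + 1)) :
    Finset.univ.erase v = Finset.univ.image v.succAbove := by
  ext x
  simp

/-- If a labelling of a simplex is flat everywhere except at the facet opposite to `v`, it is
flat there too. -/
theorem isFlatAt_erase {n : ℕ} (hn : n ≤ 5) {c : Finset (Fin (n + 1)) → G × H × L}
    (v : Fin (n + 1)) (hc : ∀ s, s ≠ Finset.univ.erase v → X.IsFlatAt c s) :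
    X.IsFlatAt c (Finset.univ.erase v) := by
  have hne {u : Fin (n + 1)} (h : u ≠ v) :
      (Finset.univ.erase u : Finset (Fin (n + 1))) ≠ Finset.univ.erase v := fun e =>
    Finset.notMem_erase u _ (e ▸ Finset.mem_erase.2 ⟨h, Finset.mem_univ u⟩)
  have hcard : (Finset.univ.erase v : Finset (Fin (n + 1))).card = n := by simp
  have hlt {s : Finset (Fin (n + 1))} (h : s.card ≠ n) : X.IsFlatAt c s :=
    hc s fun e => h (e ▸ hcard)
  by_cases h3 : n < 3
  · exact isFlatAt_of_card (by omega) (by omega) (by omega)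
  obtain rfl | rfl | rfl : n = 3 ∨ n = 4 ∨ n = 5 := by omega
  · rw [isFlatAt_triangle (Fin.strictMono_succAbove v) (univ_erase_eq_image v)]
    refine X.triHol_of_tetHol (l := lLabel c) ?_ v fun u hu => ?_
    · exact (isFlatAt_tetrahedron strictMono_id (by simp)).1 (hlt (s := Finset.univ) (by simp))
    · rw [← isFlatAt_triangle (Fin.strictMono_succAbove u) (univ_erase_eq_image u)]
      exact hc _ (hne hu)
  · rw [isFlatAt_tetrahedron (Fin.strictMono_succAbove v) (univ_erase_eq_image v)]
    refine X.tetHol_of_fourHol (fun a b d hab hbd => ?_) ?_ v fun u hu => ?_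
    · refine triHol_of_isFlatAt hab hbd (hlt ?_)
      have := Finset.card_le_three (a := a) (b := b) (c := d)
      omega
    · exact (isFlatAt_fourSimplex strictMono_id (by simp)).1 (hlt (s := Finset.univ) (by simp))
    · rw [← isFlatAt_tetrahedron (Fin.strictMono_succAbove u) (univ_erase_eq_image u)]
      exact hc _ (hne hu)
  · rw [isFlatAt_fourSimplex (Fin.strictMono_succAbove v) (univ_erase_eq_image v)]
    refine X.fourHol_of_fourHol (fun a b d hab hbd => ?_) (fun a b d e hab hbd hde => ?_) v
      fun u hu => ?_
    · refine triHol_of_isFlatAt hab hbd (hlt ?_)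
      have := Finset.card_le_three (a := a) (b := b) (c := d)
      omega
    · refine tetHol_of_isFlatAt hab hbd hde (hlt ?_)
      have := Finset.card_le_four (a := a) (b := b) (c := d) (d := e)
      omega
    · rw [← isFlatAt_fourSimplex (Fin.strictMono_succAbove u) (univ_erase_eq_image u)]
      exact hc _ (hne hu)

end Horn

end TwoCrossedModule

/-! ### Flatness of a simplex determines the label of any one facet -/

namespace TwoCrossedModule

variable {G H L : Type*} [Group G] [Group H] [Group L]
  [MulDistribMulAction G H] [MulDistribMulAction G L] {X : TwoCrossedModule G H L}

theorem existsUnique_triangle (c : Finset (Fin 3) → G × H × L) (v : Fin 3) :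
    ∃! y, y ∈ labels G H L 2 ∧
      X.IsFlatAt (Function.update c (Finset.univ.erase v) y) Finset.univ := by
  refine existsUnique_labels_two ?_
  have he : (Finset.univ : Finset (Fin 3)) = Finset.univ.image id := by simp
  simp only [isFlatAt_triangle strictMono_id he, triHol, gLabel, hLabel, id, Function.update_apply]
  have id' := Function.bijective_id (α := G)
  have inv' := (Equiv.inv G).bijective
  fin_cases v
  · have := existsUnique_mul_mul_eq_one id' (X.bd (c {0, 1, 2}).2.1)
      ((c {0, 1}).1 * (c {0, 2}).1⁻¹)
    simpa +decide [mul_assoc] using this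
  · have := existsUnique_mul_mul_eq_one inv'
      (X.bd (c {0, 1, 2}).2.1 * (c {1, 2}).1 * (c {0, 1}).1) 1
    simpa +decide [mul_assoc] using this
  · have := existsUnique_mul_mul_eq_one id'
      (X.bd (c {0, 1, 2}).2.1 * (c {1, 2}).1) (c {0, 2}).1⁻¹
    simpa +decide [mul_assoc] using this

theorem existsUnique_tetrahedron (c : Finset (Fin 4) → G × H × L) (v : Fin 4) :
    ∃! y, y ∈ labels G H L 3 ∧
      X.IsFlatAt (Function.update c (Finset.univ.erase v) y) Finset.univ := by
  refine existsUnique_labels_three ?_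
  have he : (Finset.univ : Finset (Fin 4)) = Finset.univ.image id := by simp
  simp only [isFlatAt_tetrahedron strictMono_id he, tetHol, gLabel, hLabel, lLabel, id,
    Function.update_apply]
  have id' := Function.bijective_id (α := H)
  have inv' := (Equiv.inv H).bijective
  fin_cases v
  · have := existsUnique_mul_mul_eq_one inv' (X.dl (c {0, 1, 2, 3}).2.2 * (c {0, 2, 3}).2.1 *
      (c {2, 3}).1 • (c {0, 1, 2}).2.1) (c {0, 1, 3}).2.1⁻¹
    simpa +decide [mul_assoc] using this
  · have := existsUnique_mul_mul_eq_one id' (X.dl (c {0, 1, 2, 3}).2.2)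
      ((c {2, 3}).1 • (c {0, 1, 2}).2.1 * (c {1, 2, 3}).2.1⁻¹ * (c {0, 1, 3}).2.1⁻¹)
    simpa +decide [mul_assoc] using this
  · have := existsUnique_mul_mul_eq_one inv' (X.dl (c {0, 1, 2, 3}).2.2 * (c {0, 2, 3}).2.1 *
      (c {2, 3}).1 • (c {0, 1, 2}).2.1 * (c {1, 2, 3}).2.1⁻¹) 1
    simpa +decide [mul_assoc] using this
  · have := existsUnique_mul_mul_eq_one (MulAction.bijective (β := H) (c {2, 3}).1)
      (X.dl (c {0, 1, 2, 3}).2.2 * (c {0, 2, 3}).2.1)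
      ((c {1, 2, 3}).2.1⁻¹ * (c {0, 1, 3}).2.1⁻¹)
    simpa +decide [mul_assoc] using this

theorem existsUnique_fourSimplex (c : Finset (Fin 5) → G × H × L) (v : Fin 5) :
    ∃! y, y ∈ labels G H L 4 ∧
      X.IsFlatAt (Function.update c (Finset.univ.erase v) y) Finset.univ := by
  refine existsUnique_labels_four ?_
  have he : (Finset.univ : Finset (Fin 5)) = Finset.univ.image id := by simp
  simp only [isFlatAt_fourSimplex strictMono_id he, fourHol, gLabel, hLabel, lLabel, id,
    Function.update_apply]
  have id' := Function.bijective_id (α := L)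
  have inv' := (Equiv.inv L).bijective
  set m := X.act (c {0, 2, 4}).2.1
    (X.lift (c {2, 3, 4}).2.1 (((c {3, 4}).1 * (c {2, 3}).1) • (c {0, 1, 2}).2.1)) with hm
  fin_cases v
  · have := existsUnique_mul_mul_eq_one (X.act_bijective (c {0, 1, 4}).2.1)
      ((c {0, 2, 3, 4}).2.2⁻¹ * m * (c {0, 1, 2, 4}).2.2⁻¹)
      ((c {0, 1, 3, 4}).2.2 * X.act (c {0, 3, 4}).2.1 ((c {3, 4}).1 • (c {0, 1, 2, 3}).2.2))
    simpa +decide [mul_assoc, hm] using this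
  · have := existsUnique_mul_mul_eq_one inv' 1
      (m * (c {0, 1, 2, 4}).2.2⁻¹ * X.act (c {0, 1, 4}).2.1 (c {1, 2, 3, 4}).2.2 *
      (c {0, 1, 3, 4}).2.2 * X.act (c {0, 3, 4}).2.1 ((c {3, 4}).1 • (c {0, 1, 2, 3}).2.2))
    simpa +decide [mul_assoc, hm] using this
  · have := existsUnique_mul_mul_eq_one id'
      ((c {0, 2, 3, 4}).2.2⁻¹ * m * (c {0, 1, 2, 4}).2.2⁻¹ *
        X.act (c {0, 1, 4}).2.1 (c {1, 2, 3, 4}).2.2)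
      (X.act (c {0, 3, 4}).2.1 ((c {3, 4}).1 • (c {0, 1, 2, 3}).2.2))
    simpa +decide [mul_assoc, hm] using this
  · have := existsUnique_mul_mul_eq_one inv' ((c {0, 2, 3, 4}).2.2⁻¹ * m)
      (X.act (c {0, 1, 4}).2.1 (c {1, 2, 3, 4}).2.2 *
      (c {0, 1, 3, 4}).2.2 * X.act (c {0, 3, 4}).2.1 ((c {3, 4}).1 • (c {0, 1, 2, 3}).2.2))
    simpa +decide [mul_assoc, hm] using this
  · have := existsUnique_mul_mul_eq_one
      ((X.act_bijective (c {0, 3, 4}).2.1).comp (MulAction.bijective (β := L) (c {3, 4}).1))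
      ((c {0, 2, 3, 4}).2.2⁻¹ * m * (c {0, 1, 2, 4}).2.2⁻¹ *
        X.act (c {0, 1, 4}).2.1 (c {1, 2, 3, 4}).2.2 * (c {0, 1, 3, 4}).2.2) 1
    simpa +decide [mul_assoc, hm] using this

theorem existsUnique_isFlatAt_univ {n : ℕ} (hn : 1 ≤ n) (hn' : n ≤ 5)
    (c : Finset (Fin (n + 1)) → G × H × L) (v : Fin (n + 1)) :
    ∃! y, y ∈ labels G H L n ∧
      X.IsFlatAt (Function.update c (Finset.univ.erase v) y) Finset.univ := by
  obtain rfl | rfl | rfl | h : n = 2 ∨ n = 3 ∨ n = 4 ∨ (n = 1 ∨ n = 5) := by omega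
  · exact existsUnique_triangle c v
  · exact existsUnique_tetrahedron c v
  · exact existsUnique_fourSimplex c v
  -- For an edge or a 5-simplex there is no flatness condition, and the facet, a vertex or a
  -- 4-simplex, has only the trivial label.
  · refine ⟨1, ⟨(mem_labels_trivial (by omega) (by omega) (by omega)).2 rfl,
      isFlatAt_of_card ?_ ?_ ?_⟩,
      fun y hy => (mem_labels_trivial (by omega) (by omega) (by omega)).1 hy.1⟩ <;>
    · rw [Finset.card_univ, Fintype.card_fin]
      omega

end TwoCrossedModule

/-! ### Counting flat labellings under horn fillings -/

namespace TwoCrossedModule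

variable {G H L : Type*} [Group G] [Group H] [Group L]
  [MulDistribMulAction G H] [MulDistribMulAction G L] (X : TwoCrossedModule G H L)
  {V : Type*} [LinearOrder V]

theorem map_orderEmbOfFin_univ {σ : Finset V} {k : ℕ} (h : σ.card = k) :
    (Finset.univ.map (σ.orderEmbOfFin h).toEmbedding) = σ := by
  simp

variable {X}

/-- Transported from the standard simplex along the increasing enumeration of `σ`. -/
theorem existsUnique_isFlatAt {σ : Finset V} {v : V} (hv : v ∈ σ) (h1 : 2 ≤ σ.card)
    (h6 : σ.card ≤ 6) (c : Finset V → G × H × L) :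
    ∃! y, y ∈ labels G H L (σ.card - 1) ∧ X.IsFlatAt (Function.update c (σ.erase v) y) σ := by
  obtain ⟨n, hn⟩ : ∃ n, σ.card = n + 1 := ⟨σ.card - 1, by omega⟩
  set e := σ.orderEmbOfFin hn
  have hσ : Finset.univ.map e.toEmbedding = σ := map_orderEmbOfFin_univ hn
  obtain ⟨w, rfl⟩ : ∃ w, e w = v := by rw [← hσ] at hv; simpa using hv
  have hτ : (Finset.univ.erase w).map e.toEmbedding = σ.erase (e w) := by
    rw [Finset.map_erase, hσ]; rfl
  have hu (y) : (fun r => Function.update c (σ.erase (e w)) y (r.map e.toEmbedding)) =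
      Function.update (fun r => c (r.map e.toEmbedding)) (Finset.univ.erase w) y := by
    rw [← hτ]
    exact Function.update_comp_eq_of_injective c (Finset.map_injective e.toEmbedding) _ y
  have := existsUnique_isFlatAt_univ (X := X) (by omega) (by omega)
    (fun r => c (r.map e.toEmbedding)) w
  simp only [← hu, isFlatAt_map, hσ] at this
  rwa [hn, Nat.add_sub_cancel]

theorem isFlatAt_erase_of_isFlatAt {σ : Finset V} {v : V} (hv : v ∈ σ) (h6 : σ.card ≤ 6)
    {c : Finset V → G × H × L} (hc : ∀ s ⊆ σ, s ≠ σ.erase v → X.IsFlatAt c s) :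
    X.IsFlatAt c (σ.erase v) := by
  have := Finset.card_pos.2 ⟨v, hv⟩
  obtain ⟨n, hn⟩ : ∃ n, σ.card = n + 1 := ⟨σ.card - 1, by omega⟩
  set e := σ.orderEmbOfFin hn
  have hσ : Finset.univ.map e.toEmbedding = σ := map_orderEmbOfFin_univ hn
  obtain ⟨w, rfl⟩ : ∃ w, e w = v := by rw [← hσ] at hv; simpa using hv
  have hτ : (Finset.univ.erase w).map e.toEmbedding = σ.erase (e w) := by
    rw [Finset.map_erase, hσ]; rfl
  rw [← hτ, ← isFlatAt_map]
  refine isFlatAt_erase (by omega) w fun s hs => (isFlatAt_map e s).2 (hc _ ?_ ?_)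
  · rw [← hσ]
    exact Finset.map_subset_map.2 (Finset.subset_univ s)
  · rw [← hτ]
    exact fun h => hs (Finset.map_injective _ h)

variable (X)

/-- The flat labellings of a finite set `F` of simplices. -/
def flatLabellings (F : Finset (Finset V)) : Set (Finset V → G × H × L) :=
  {c | (∀ s ∉ F, c s = 1) ∧ ∀ s ∈ F, c s ∈ labels G H L s.card ∧ X.IsFlatAt c s}

/-- Filling a horn: adding to `F` a simplex `σ` and its facet opposite to `v`, where all the other
proper faces of `σ` are in `F`, multiplies the number of flat labellings by the number of labels
of `σ`. -/
theorem card_flatLabellings_insert {F : Finset (Finset V)} {σ : Finset V} {v : V} (hv : v ∈ σ)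
    (h1 : 2 ≤ σ.card) (h6 : σ.card ≤ 6) (hF : ∀ s ∈ F, ¬ σ.erase v ⊆ s)
    (hσ : ∀ s ⊆ σ, s.Nonempty → s ≠ σ → s ≠ σ.erase v → s ∈ F) :
    Nat.card (X.flatLabellings (insert σ (insert (σ.erase v) F))) =
      Nat.card (X.flatLabellings F) * Nat.card (labels G H L σ.card) := by
  set τ := σ.erase v with hτ
  have hτσ : τ ≠ σ := (Finset.erase_ssubset hv).ne
  have hτs : τ ⊆ σ := Finset.erase_subset v σ
  have hτc : τ.card = σ.card - 1 := Finset.card_erase_of_mem hv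
  have hτF : τ ∉ F := fun h => hF τ h subset_rfl
  have hσF : σ ∉ F := fun h => hF σ h hτs
  have hneτ {r s} (hs : s ∈ F) (hr : r ⊆ s) : r ≠ τ := fun h => hF s hs (h ▸ hr)
  have hneσ {r s} (hs : s ∈ F) (hr : r ⊆ s) : r ≠ σ := fun h => hF s hs (hτs.trans (h ▸ hr))
  have hcongr {c c' : Finset V → G × H × L} (h : ∀ r, r ≠ τ → r ≠ σ → c r = c' r) {s}
      (hs : s ∈ F) : X.IsFlatAt c s ↔ X.IsFlatAt c' s :=
    isFlatAt_congr fun r hr => h r (hneτ hs hr) (hneσ hs hr)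
  rw [← Nat.card_prod]
  -- The bijection resets the labels of `σ` and `τ` to the default `1` and records the label of `σ`;
  -- the label of `τ` is forgotten because it can be recovered.
  refine Nat.card_congr (Equiv.ofBijective (fun c =>
    (⟨Function.update (Function.update c.1 σ 1) τ 1, ?_, ?_⟩, ⟨c.1 σ, ?_⟩)) ⟨?_, ?_⟩)
  · intro s hs
    by_cases hsτ : s = τ
    · simp [hsτ]
    by_cases hsσ : s = σ
    · simp [hsσ, hτσ.symm]
    · simpa [hsτ, hsσ] using c.2.1 s (by simp [hs, hsτ, hsσ])
  · intro s hs
    have h₁ := hneτ hs subset_rfl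
    have h₂ := hneσ hs subset_rfl
    have h₃ := c.2.2 s (by simp [hs])
    refine ⟨by simpa [h₁, h₂] using h₃.1, (hcongr (fun r hr hr' => ?_) hs).2 h₃.2⟩
    simp [hr, hr']
  · exact (c.2.2 σ (by simp)).1
  · rintro ⟨c, hc⟩ ⟨c', hc'⟩ h
    simp only [Prod.mk.injEq, Subtype.mk.injEq] at h
    have hd : Function.update c τ 1 = Function.update c' τ 1 := by
      funext r
      by_cases hrσ : r = σ
      · subst hrσ
        simpa [hτσ.symm] using h.2
      · have := congrFun (Subtype.ext_iff.1 h.1) r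
        by_cases hrτ : r = τ
        · simp [hrτ]
        · simpa [hrτ, hrσ] using this
    -- Both labels of `τ` solve the flatness equation of `σ` with the same remaining data.
    have he : c τ = c' τ := by
      refine (existsUnique_isFlatAt (X := X) hv h1 h6 (Function.update c τ 1)).unique
        ⟨?_, ?_⟩ ⟨?_, ?_⟩
      · rw [← hτc]; exact (hc.2 τ (by simp)).1
      · rw [← hτ, Function.update_idem, Function.update_eq_self]
        exact (hc.2 σ (by simp)).2
      · rw [← hτc]; exact (hc'.2 τ (by simp)).1
      · rw [← hτ, hd, Function.update_idem, Function.update_eq_self]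
        exact (hc'.2 σ (by simp)).2
    refine Subtype.ext (funext fun r => ?_)
    by_cases hr : r = τ
    · rw [hr]; exact he
    · simpa [hr] using congrFun hd r
  · rintro ⟨⟨c, hc⟩, ⟨x, hx⟩⟩
    -- The label `y` of `τ` is chosen to make `σ` flat; flatness of `τ` itself then comes for free.
    obtain ⟨y, ⟨hy, hyσ⟩, -⟩ := existsUnique_isFlatAt (X := X) hv h1 h6 (Function.update c σ x)
    rw [← hτ] at hyσ
    rw [← hτc] at hy
    set d := Function.update (Function.update c σ x) τ y with hd
    have hdc (r) (hr : r ≠ τ) (hr' : r ≠ σ) : d r = c r := by simp [hd, hr, hr']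
    have hF' : ∀ s ∈ F, X.IsFlatAt d s := fun s hs => (hcongr hdc hs).2 (hc.2 s hs).2
    have hdτ : X.IsFlatAt d τ := by
      refine isFlatAt_erase_of_isFlatAt hv h6 fun s hs hne => ?_
      by_cases hsσ : s = σ
      · rw [hsσ]; exact hyσ
      obtain rfl | hs0 := s.eq_empty_or_nonempty
      · exact isFlatAt_of_card (by simp) (by simp) (by simp)
      · exact hF' s (hσ s hs hs0 hsσ hne)
    refine ⟨⟨d, fun s hs => ?_, fun s hs => ?_⟩, ?_⟩
    · simp only [Finset.mem_insert, not_or] at hs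
      rw [hdc s hs.2.1 hs.1]
      exact hc.1 s hs.2.2
    · rw [Finset.mem_insert, Finset.mem_insert] at hs
      obtain rfl | rfl | hs := hs
      · exact ⟨by simpa [hd, hτσ.symm] using hx, hyσ⟩
      · exact ⟨by simpa [hd] using hy, hdτ⟩
      · refine ⟨?_, hF' s hs⟩
        rw [hdc s (hneτ hs subset_rfl) (hneσ hs subset_rfl)]
        exact (hc.2 s hs).1
    · simp only [Prod.mk.injEq, Subtype.mk.injEq]
      refine ⟨Subtype.ext (funext fun r => ?_), by simp [hd, hτσ.symm]⟩
      by_cases hr : r = τ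
      · simpa [hr] using (hc.1 τ hτF).symm
      by_cases hr' : r = σ
      · simpa [hr', hτσ.symm] using (hc.1 σ hσF).symm
      · simp [hr, hr', hdc]

/-- The number of simplices in `F` with `n` vertices. -/
def count (F : Finset (Finset V)) (n : ℕ) : ℤ := (F.filter (fun s => s.card = n)).card

/-- The number of flat labellings, normalized so as to be invariant under filling horns. -/
noncomputable def partition (F : Finset (Finset V)) : ℝ :=
  (Nat.card G : ℝ) ^ (-count F 1) * (Nat.card H : ℝ) ^ (count F 1 - count F 2) *
    (Nat.card L : ℝ) ^ (-count F 1 + count F 2 - count F 3) * Nat.card (X.flatLabellings F)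

theorem count_insert {F : Finset (Finset V)} {s : Finset V} (hs : s ∉ F) (n : ℕ) :
    count (insert s F) n = count F n + if s.card = n then 1 else 0 := by
  rw [count, Finset.filter_insert]
  split_ifs
  · rw [Finset.card_insert_of_notMem (by simp [hs])]
    push_cast
    rfl
  · simp [count]

variable [Finite G] [Finite H] [Finite L]

/-- The number of flat labellings gains a factor `|G|`, `|H|`, `|L|` or `1` according as `σ` has 2,
3, 4 or more vertices. The counts of `σ` and `τ` cancel in every exponent except the one that
compensates this factor. -/
theorem partition_insert {F : Finset (Finset V)} {σ : Finset V} {v : V} (hv : v ∈ σ)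
    (h1 : 2 ≤ σ.card) (h6 : σ.card ≤ 6) (hF : ∀ s ∈ F, ¬ σ.erase v ⊆ s)
    (hσ : ∀ s ⊆ σ, s.Nonempty → s ≠ σ → s ≠ σ.erase v → s ∈ F) :
    X.partition (insert σ (insert (σ.erase v) F)) = X.partition F := by
  have hτc : (σ.erase v).card = σ.card - 1 := Finset.card_erase_of_mem hv
  have hτF : σ.erase v ∉ F := fun h => hF _ h subset_rfl
  have hσF : σ ∉ insert (σ.erase v) F := by
    rw [Finset.mem_insert, not_or]
    exact ⟨fun h => Finset.notMem_erase v σ (h ▸ hv), fun h => hF _ h (Finset.erase_subset v σ)⟩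
  have hG : (Nat.card G : ℝ) ≠ 0 := by exact_mod_cast Nat.card_pos.ne'
  have hH : (Nat.card H : ℝ) ≠ 0 := by exact_mod_cast Nat.card_pos.ne'
  have hL : (Nat.card L : ℝ) ≠ 0 := by exact_mod_cast Nat.card_pos.ne'
  rw [partition, partition, X.card_flatLabellings_insert hv h1 h6 hF hσ]
  have hc (k) := (count_insert hσF k).trans (congrArg (· + _) (count_insert hτF k))
  simp only [hτc] at hc
  obtain h | h | h | h : σ.card = 2 ∨ σ.card = 3 ∨ σ.card = 4 ∨ (σ.card ≠ 2 ∧ 4 < σ.card) := by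
    omega
  · have h₁ := hc 1
    have h₂ := hc 2
    have h₃ := hc 3
    norm_num [h] at h₁ h₂ h₃
    rw [h, card_labels_two, h₁, h₂, h₃, add_sub_add_right_eq_sub, neg_add, zpow_add₀ hG,
      zpow_neg_one, show -count F 1 + -1 + (count F 2 + 1) = -count F 1 + count F 2 by ring]
    push_cast
    field_simp
  · have h₁ := hc 1
    have h₂ := hc 2
    have h₃ := hc 3
    norm_num [h] at h₁ h₂ h₃
    rw [h, card_labels_three, h₁, h₂, h₃, ← sub_sub, sub_eq_add_neg _ 1, zpow_add₀ hH,
      zpow_neg_one, show -count F 1 + (count F 2 + 1) - (count F 3 + 1) =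
        -count F 1 + count F 2 - count F 3 by ring]
    push_cast
    field_simp
  · have h₁ := hc 1
    have h₂ := hc 2
    have h₃ := hc 3
    norm_num [h] at h₁ h₂ h₃
    rw [h, card_labels_four, h₁, h₂, h₃, ← sub_sub, sub_eq_add_neg _ 1, zpow_add₀ hL,
      zpow_neg_one]
    push_cast
    field_simp
  · have h₀ (k) (hk : k < 4) : count (insert σ (insert (σ.erase v) F)) k = count F k := by
      rw [hc, if_neg (by omega), if_neg (by omega), add_zero, add_zero]
    rw [h₀ 1 (by omega), h₀ 2 (by omega), h₀ 3 (by omega),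
      card_labels_trivial (by omega) (by omega) (by omega), mul_one]

/-- Adding to `F` the join of `B` with the full simplex on `A`, where the joins of the proper faces
of `B` with the faces of `A` are already in `F`, is a sequence of horn fillings. -/
theorem partition_join {A : Finset V} (hA : A.Nonempty) :
    ∀ (B : Finset V) (F : Finset (Finset V)),
    B.Nonempty → Disjoint A B → A.card + B.card ≤ 6 → (∀ s ∈ F, ¬ B ⊆ s) →
    (∀ C ⊆ A, ∀ D ⊂ B, (C ∪ D).Nonempty → C ∪ D ∈ F) →
    X.partition (F ∪ A.powerset.image (· ∪ B)) = X.partition F := by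
  induction hA using Finset.Nonempty.cons_induction with
  | singleton a =>
    intro B F hB hAB h6 hF hj
    have ha : a ∉ B := by simpa using hAB
    have he : (insert a B).erase a = B := Finset.erase_insert ha
    have hc : (insert a B).card = B.card + 1 := Finset.card_insert_of_notMem ha
    have := Finset.card_pos.2 hB
    rw [Finset.card_singleton] at h6
    have key := X.partition_insert (F := F) (Finset.mem_insert_self a B) (by omega) (by omega)
      (by rwa [he]) (fun s hs hs0 hne hne' => ?_)
    · rw [← key, he]
      congr 1
      ext s
      simp only [Finset.mem_union, Finset.mem_image, Finset.mem_powerset,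
        Finset.subset_singleton_iff,
        exists_eq_or_imp, exists_eq_left, Finset.empty_union, Finset.mem_insert,
        Finset.singleton_union, eq_comm (b := s)]
      tauto
    · rw [he] at hne'
      have hs' : s ∩ {a} ∪ s ∩ B = s := by
        rw [← Finset.inter_union_distrib_left]
        exact Finset.inter_eq_left.2 hs
      rw [← hs']
      refine hj _ Finset.inter_subset_right _ ?_ (by rwa [hs'])
      refine Finset.ssubset_iff_subset_ne.2 ⟨Finset.inter_subset_right, fun h => ?_⟩
      rw [Finset.inter_eq_right] at h
      by_cases has : a ∈ s
      · exact hne (hs.antisymm (Finset.insert_subset has h))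
      · exact hne' (((Finset.subset_insert_iff_of_notMem has).1 hs).antisymm h)
  | cons b A hb hA ih =>
    intro B F hB hAB h6 hF hj
    rw [Finset.card_cons] at h6
    rw [Finset.cons_eq_insert, Finset.disjoint_insert_left] at hAB
    have e₁ := ih B F hB hAB.2 (by omega) hF
      fun C hC => hj C (hC.trans (Finset.subset_cons hb))
    have hc : (insert b B).card = B.card + 1 := Finset.card_insert_of_notMem hAB.1
    -- After the joins with `B` are added, the induction hypothesis is applied again with `b` moved
    -- over to the other factor; this supplies the remaining simplices, those containing `b`.
    have e₂ := ih (insert b B) (F ∪ A.powerset.image (· ∪ B)) (Finset.insert_nonempty b B)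
      (by simp [Finset.disjoint_insert_right, hb, hAB.2]) (by omega) (fun s hs hsub => ?_)
      (fun C hC D hD hne => ?_)
    · rw [← e₁, ← e₂]
      congr 1
      ext s
      simp only [Finset.mem_union, Finset.mem_image, Finset.cons_eq_insert, Finset.powerset_insert]
      simp only [or_assoc, or_and_right, exists_or]
      have : ∀ C : Finset V, insert b C ∪ B = C ∪ insert b B := fun C => by
        rw [Finset.insert_union, Finset.union_insert]
      simp [this]
    · rw [Finset.mem_union, Finset.mem_image] at hs
      obtain hs | ⟨C, hC, rfl⟩ := hs
      · exact hF s hs ((Finset.subset_insert b B).trans hsub)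
      · have := hsub (Finset.mem_insert_self b B)
        rw [Finset.mem_union] at this
        exact this.elim (fun h => hb (Finset.mem_powerset.1 hC h)) hAB.1
    · by_cases hbD : b ∈ D
      -- If `b ∈ D`, moving `b` back to `C` exhibits `C ∪ D` as a simplex already in `F`.
      · have hD' : D.erase b ⊂ B := by
          refine Finset.ssubset_iff_subset_ne.2 ⟨fun x hx => ?_, fun h => hD.ne ?_⟩
          · exact (Finset.mem_insert.1 (hD.1 (Finset.mem_of_mem_erase hx))).resolve_left
              (Finset.ne_of_mem_erase hx)
          · rw [← h, Finset.insert_erase hbD]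
        have e : C ∪ D = insert b C ∪ D.erase b := by
          rw [Finset.insert_union, ← Finset.union_insert, Finset.insert_erase hbD]
        rw [e] at hne ⊢
        refine Finset.mem_union_left _ (hj _ ?_ _ hD' hne)
        rw [Finset.cons_eq_insert]
        exact Finset.insert_subset_insert b hC
      · have hDB : D ⊆ B := (Finset.subset_insert_iff_of_notMem hbD).1 hD.1
        by_cases hDB' : D = B
        · exact Finset.mem_union_right _ (Finset.mem_image.2
            ⟨C, Finset.mem_powerset.2 hC, by rw [hDB']⟩)
        · exact Finset.mem_union_left _ (hj C (hC.trans (Finset.subset_cons hb)) D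
            (Finset.ssubset_iff_subset_ne.2 ⟨hDB, hDB'⟩) hne)

end TwoCrossedModule

/-! ### The state sum as a normalized count, and Pachner moves -/

namespace FiniteComplex

open TwoCrossedModule

variable {V : Type*}

/-- The finite set of simplices of a finite complex. -/
noncomputable def simplices (K : FiniteComplex V) : Finset (Finset V) := K.finite_faces.toFinset

theorem mem_simplices {K : FiniteComplex V} {s : Finset V} : s ∈ K.simplices ↔ s ∈ K.faces := by
  simp [simplices]

theorem numSimplices_eq (K : FiniteComplex V) (k : ℕ) :
    K.numSimplices k = count K.simplices (k + 1) := by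
  rw [numSimplices, count, ← Fintype.card_coe]
  congr 1
  exact Fintype.card_congr (Equiv.subtypeEquivRight fun s => by simp [mem_simplices])

variable [LinearOrder V] (K : FiniteComplex V)
  {G H L : Type*} [Group G] [Group H] [Group L]
  [MulDistribMulAction G H] [MulDistribMulAction G L] (X : TwoCrossedModule G H L)

/-- A labelling of the edges, triangles and tetrahedra is flat. -/
def IsFlat (x : (K.Simplex 1 → G) × (K.Simplex 2 → H) × (K.Simplex 3 → L)) : Prop :=
  (∀ t, K.triangleHolonomy X x.1 x.2.1 t = 1) ∧
    (∀ t, K.tetrahedronHolonomy X x.1 x.2.1 x.2.2 t = 1) ∧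
    ∀ s, K.fourSimplexHolonomy X x.1 x.2.1 x.2.2 s = 1

/-- The labels of the edges, triangles and tetrahedra of `K`. -/
def restrictLabels (c : Finset V → G × H × L) :
    (K.Simplex 1 → G) × (K.Simplex 2 → H) × (K.Simplex 3 → L) :=
  (fun t => (c t.1).1, fun t => (c t.1).2.1, fun t => (c t.1).2.2)

variable {X}

theorem isFlat_restrictLabels {c : Finset V → G × H × L} :
    K.IsFlat X (K.restrictLabels c) ↔ ∀ s ∈ K.simplices, X.IsFlatAt c s := by
  have h3 (t : K.Simplex 2) : t.1 = {t.1.orderEmbOfFin t.2.2 0, t.1.orderEmbOfFin t.2.2 1,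
      t.1.orderEmbOfFin t.2.2 2} := by
    conv_lhs => rw [← map_orderEmbOfFin_univ t.2.2,
      show (Finset.univ : Finset (Fin 3)) = {0, 1, 2} from rfl]
    simp only [Finset.map_insert, Finset.map_singleton]
    rfl
  have h4 (t : K.Simplex 3) : t.1 = {t.1.orderEmbOfFin t.2.2 0, t.1.orderEmbOfFin t.2.2 1,
      t.1.orderEmbOfFin t.2.2 2, t.1.orderEmbOfFin t.2.2 3} := by
    conv_lhs => rw [← map_orderEmbOfFin_univ t.2.2,
      show (Finset.univ : Finset (Fin 4)) = {0, 1, 2, 3} from rfl]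
    simp only [Finset.map_insert, Finset.map_singleton]
    rfl
  have e₁ (t) : K.triangleHolonomy X (K.restrictLabels c).1 (K.restrictLabels c).2.1 t =
      X.triHol (gLabel c) (hLabel c) (t.1.orderEmbOfFin t.2.2 0) (t.1.orderEmbOfFin t.2.2 1)
        (t.1.orderEmbOfFin t.2.2 2) := by
    simp only [triangleHolonomy, restrictLabels, triHol, gLabel, hLabel, face, ← h3,
      Finset.map_insert, Finset.map_singleton]
    rfl
  have e₂ (t) : K.tetrahedronHolonomy X (K.restrictLabels c).1 (K.restrictLabels c).2.1
      (K.restrictLabels c).2.2 t =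
      X.tetHol (gLabel c) (hLabel c) (lLabel c) (t.1.orderEmbOfFin t.2.2 0)
        (t.1.orderEmbOfFin t.2.2 1) (t.1.orderEmbOfFin t.2.2 2) (t.1.orderEmbOfFin t.2.2 3) := by
    simp only [tetrahedronHolonomy, restrictLabels, tetHol, gLabel, hLabel, lLabel, face, ← h4,
      Finset.map_insert, Finset.map_singleton]
    rfl
  have e₃ (t) : K.fourSimplexHolonomy X (K.restrictLabels c).1 (K.restrictLabels c).2.1
      (K.restrictLabels c).2.2 t =
      X.fourHol (gLabel c) (hLabel c) (lLabel c) (t.1.orderEmbOfFin t.2.2 0)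
        (t.1.orderEmbOfFin t.2.2 1) (t.1.orderEmbOfFin t.2.2 2) (t.1.orderEmbOfFin t.2.2 3)
        (t.1.orderEmbOfFin t.2.2 4) := by
    simp only [fourSimplexHolonomy, restrictLabels, fourHol, gLabel, hLabel, lLabel, face,
      Finset.map_insert, Finset.map_singleton]
    rfl
  simp only [IsFlat, e₁, e₂, e₃, mem_simplices, IsFlatAt]
  constructor
  · rintro ⟨f₁, f₂, f₃⟩ s hs
    exact ⟨fun h => f₁ ⟨s, hs, h⟩, fun h => f₂ ⟨s, hs, h⟩, fun h => f₃ ⟨s, hs, h⟩⟩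
  · intro f
    exact ⟨fun t => (f t.1 t.2.1).1 t.2.2, fun t => (f t.1 t.2.1).2.1 t.2.2,
      fun t => (f t.1 t.2.1).2.2 t.2.2⟩

/-- Extension by `1` is inverse to restriction, since a labelling in `flatLabellings` is trivial off
`K` and in the components not belonging to the dimension. -/
theorem card_isFlat :
    Nat.card {x : (K.Simplex 1 → G) × (K.Simplex 2 → H) × (K.Simplex 3 → L) // K.IsFlat X x} =
      Nat.card (X.flatLabellings K.simplices) := by
  classical
  symm
  refine Nat.card_congr (Equiv.ofBijective (fun c => ⟨K.restrictLabels c.1,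
    K.isFlat_restrictLabels.2 fun s hs => (c.2.2 s hs).2⟩) ⟨?_, ?_⟩)
  · rintro ⟨c, hc⟩ ⟨c', hc'⟩ h
    simp only [Subtype.mk.injEq, restrictLabels, Prod.mk.injEq, funext_iff] at h
    refine Subtype.ext (funext fun s => ?_)
    change c s = c' s
    by_cases hs : s ∈ K.simplices
    · obtain ⟨a₁, a₂, a₃⟩ := (hc.2 s hs).1
      obtain ⟨b₁, b₂, b₃⟩ := (hc'.2 s hs).1
      rw [mem_simplices] at hs
      refine Prod.ext ?_ (Prod.ext ?_ ?_)
      · by_cases hn : s.card = 2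
        · exact h.1 ⟨s, hs, hn⟩
        · rw [a₁ hn, b₁ hn]
      · by_cases hn : s.card = 3
        · exact h.2.1 ⟨s, hs, hn⟩
        · rw [a₂ hn, b₂ hn]
      · by_cases hn : s.card = 4
        · exact h.2.2 ⟨s, hs, hn⟩
        · rw [a₃ hn, b₃ hn]
    · rw [hc.1 s hs, hc'.1 s hs]
  · rintro ⟨⟨g, h, l⟩, hx⟩
    let c : Finset V → G × H × L := fun s =>
      (if hs : s ∈ K.faces ∧ s.card = 1 + 1 then g ⟨s, hs⟩ else 1,
        if hs : s ∈ K.faces ∧ s.card = 2 + 1 then h ⟨s, hs⟩ else 1,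
        if hs : s ∈ K.faces ∧ s.card = 3 + 1 then l ⟨s, hs⟩ else 1)
    have hc : K.restrictLabels c = (g, h, l) := by
      refine Prod.ext (funext fun t => ?_) (Prod.ext (funext fun t => ?_) (funext fun t => ?_)) <;>
      exact dif_pos t.2
    refine ⟨⟨c, fun s hs => ?_, fun s hs => ⟨?_, ?_⟩⟩, Subtype.ext hc⟩
    · rw [mem_simplices] at hs
      simp [c, hs]
    · exact ⟨fun hn => dif_neg fun h => hn h.2, fun hn => dif_neg fun h => hn h.2,
        fun hn => dif_neg fun h => hn h.2⟩
    · rw [← hc] at hx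
      exact K.isFlat_restrictLabels.1 hx s hs

theorem prod_groupDelta {ι Y : Type*} [Fintype ι] [Group Y] [Fintype Y] (f : ι → Y)
    [Decidable (∀ i, f i = 1)] :
    ∏ i, groupDelta (f i) =
      if ∀ i, f i = 1 then (Fintype.card Y : ℝ) ^ Fintype.card ι else 0 := by
  classical
  simp only [groupDelta, Finset.prod_ite_zero, Finset.mem_univ, true_implies, Finset.prod_const,
    Finset.card_univ]

/-- The averages contribute `|G|^(-|Λ₁|) |H|^(-|Λ₂|) |L|^(-|Λ₃|)` and the deltas `|G|^|Λ₂| |H|^|Λ₃|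
|L|^|Λ₄|`; these cancel the top terms of the three exponents. -/
theorem stateSum_eq_partition [Fintype G] [Fintype H] [Fintype L] :
    K.stateSum X = X.partition K.simplices := by
  classical
  have hG : (Nat.card G : ℝ) ≠ 0 := by exact_mod_cast Nat.card_pos.ne'
  have hH : (Nat.card H : ℝ) ≠ 0 := by exact_mod_cast Nat.card_pos.ne'
  have hL : (Nat.card L : ℝ) ≠ 0 := by exact_mod_cast Nat.card_pos.ne'
  have hW (g : K.Simplex 1 → G) (h : K.Simplex 2 → H) (l : K.Simplex 3 → L) :
      (∏ t : K.Simplex 2, groupDelta (K.triangleHolonomy X g h t)) *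
        (∏ t : K.Simplex 3, groupDelta (K.tetrahedronHolonomy X g h l t)) *
        (∏ s : K.Simplex 4, groupDelta (K.fourSimplexHolonomy X g h l s)) =
      if K.IsFlat X (g, h, l) then (Nat.card G : ℝ) ^ K.numSimplices 2 *
        (Nat.card H : ℝ) ^ K.numSimplices 3 * (Nat.card L : ℝ) ^ K.numSimplices 4 else 0 := by
    simp only [prod_groupDelta, numSimplices, zpow_natCast, Nat.card_eq_fintype_card, IsFlat]
    split_ifs <;> simp_all
  have hN : ∑ g : K.Simplex 1 → G, ∑ h : K.Simplex 2 → H, ∑ l : K.Simplex 3 → L,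
      (if K.IsFlat X (g, h, l) then (1 : ℝ) else 0) =
      Nat.card (X.flatLabellings K.simplices) := by
    rw [← card_isFlat, Nat.card_eq_fintype_card, Fintype.card_subtype, Finset.card_filter,
      Nat.cast_sum, Fintype.sum_prod_type]
    simp only [Fintype.sum_prod_type]
    push_cast
    rfl
  have hE : (𝔼 g : K.Simplex 1 → G, 𝔼 h : K.Simplex 2 → H, 𝔼 l : K.Simplex 3 → L,
      if K.IsFlat X (g, h, l) then (Nat.card G : ℝ) ^ K.numSimplices 2 *
        (Nat.card H : ℝ) ^ K.numSimplices 3 * (Nat.card L : ℝ) ^ K.numSimplices 4 else 0) =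
      ((Nat.card G : ℝ) ^ K.numSimplices 1)⁻¹ * ((Nat.card H : ℝ) ^ K.numSimplices 2)⁻¹ *
        ((Nat.card L : ℝ) ^ K.numSimplices 3)⁻¹ * ((Nat.card G : ℝ) ^ K.numSimplices 2 *
        (Nat.card H : ℝ) ^ K.numSimplices 3 * (Nat.card L : ℝ) ^ K.numSimplices 4) *
        Nat.card (X.flatLabellings K.simplices) := by
    rw [← hN]
    set w := (Nat.card G : ℝ) ^ K.numSimplices 2 * (Nat.card H : ℝ) ^ K.numSimplices 3 *
      (Nat.card L : ℝ) ^ K.numSimplices 4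
    have hw (p : Prop) [Decidable p] : (if p then w else 0) = w * if p then 1 else 0 := by simp
    simp only [hw, Fintype.expect_eq_sum_div_card, Fintype.card_fun, ← Finset.sum_div,
      ← Finset.mul_sum, numSimplices, zpow_natCast, Nat.card_eq_fintype_card]
    push_cast
    ring
  rw [stateSum, TwoCrossedModule.partition]
  simp only [hW]
  rw [hE]
  simp only [Nat.card_eq_fintype_card] at hG hH hL ⊢
  simp only [numSimplices_eq]
  norm_num only
  simp only [zpow_add₀ hG, zpow_add₀ hH, zpow_add₀ hL, zpow_sub₀ hG, zpow_sub₀ hH, zpow_sub₀ hL,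
    zpow_neg]
  field_simp


/-- The simplices of a complex after a Pachner move, together with those before it, form the
union of either complex with the join of the full simplices on `A` and `B`. -/
theorem simplices_union_eq {K K' : FiniteComplex V} {A B : Finset V}
    (hA : ∀ τ : Finset V, (Disjoint A τ ∧ A ∪ τ ∈ K.faces) ↔ τ ⊂ B)
    (hK' : ∀ σ : Finset V, σ ∈ K'.faces ↔ (σ ∈ K.faces ∧ ¬ A ⊆ σ) ∨ ∃ C, C ⊂ A ∧ σ = C ∪ B) :
    K.simplices ∪ A.powerset.image (· ∪ B) = K'.simplices ∪ B.powerset.image (· ∪ A) := by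
  ext σ
  simp only [Finset.mem_union, mem_simplices, Finset.mem_image, Finset.mem_powerset, hK']
  constructor
  · rintro (hσ | ⟨C, hC, rfl⟩)
    · by_cases h : A ⊆ σ
      · refine .inr ⟨σ \ A, ((hA _).1 ⟨Finset.disjoint_sdiff, ?_⟩).1,
          Finset.sdiff_union_of_subset h⟩
        rwa [Finset.union_sdiff_of_subset h]
      · exact .inl (.inl ⟨hσ, h⟩)
    · by_cases h : C = A
      · exact .inr ⟨B, subset_rfl, by rw [h, Finset.union_comm]⟩
      · exact .inl (.inr ⟨C, Finset.ssubset_iff_subset_ne.2 ⟨hC, h⟩, rfl⟩)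
  · rintro ((⟨hσ, -⟩ | ⟨C, hC, rfl⟩) | ⟨D, hD, rfl⟩)
    · exact .inl hσ
    · exact .inr ⟨C, hC.1, rfl⟩
    · by_cases h : D = B
      · exact .inr ⟨A, subset_rfl, by rw [h, Finset.union_comm]⟩
      · refine .inl ?_
        rw [Finset.union_comm]
        exact ((hA D).2 (Finset.ssubset_iff_subset_ne.2 ⟨hD, h⟩)).2

/-- The state sum is invariant under Pachner moves of finite complexes. -/
theorem stateSum_eq_of_isPachnerMove [Fintype G] [Fintype H] [Fintype L] {K K' : FiniteComplex V}
    {p q : ℕ} (hp : 1 ≤ p) (hq : 1 ≤ q) (hpq : p + q = 6) (h : IsPachnerMove p q K K') :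
    K.stateSum X = K'.stateSum X := by
  obtain ⟨A, B, hAq, hBp, hA, hB, hK'⟩ := h
  have hA0 : A.Nonempty := Finset.card_pos.1 (by omega)
  have hB0 : B.Nonempty := Finset.card_pos.1 (by omega)
  have hAK : A ∈ K.faces := by
    have := ((hA ∅).2 (Finset.empty_ssubset.2 hB0)).2
    rwa [Finset.union_empty] at this
  have hdown {s t : Finset V} (hs : s ∈ K.faces) (hts : t ⊆ s) (ht : t.Nonempty) : t ∈ K.faces :=
    (K.isRelLowerSet_faces hs).2 hts ht
  -- A common vertex `b` with `B = {b}` would make `B` a face of `A`, hence of `K`; otherwise `{b}`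
  -- lies in the link of `A` and so is disjoint from `A`.
  have hAB : Disjoint A B := by
    rw [Finset.disjoint_right]
    intro b hb hbA
    by_cases h : ({b} : Finset V) = B
    · exact hB (hdown hAK (by rw [← h]; simpa using hbA) hB0)
    · have := ((hA {b}).2 (Finset.ssubset_iff_subset_ne.2 ⟨by simpa using hb, h⟩)).1
      exact (Finset.disjoint_right.1 this (Finset.mem_singleton_self b)) hbA
  -- Both sides are extended to the common enlargement by the full simplex `A ∪ B`: no simplex of
  -- `K` contains `B`, and none of `K'` contains `A`, so `partition_join` applies with the two roles
  -- exchanged.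
  rw [stateSum_eq_partition, stateSum_eq_partition,
    ← X.partition_join hA0 B K.simplices hB0 hAB (by omega), simplices_union_eq hA hK',
    X.partition_join hB0 A K'.simplices hA0 hAB.symm (by omega)]
  · intro s hs
    rw [mem_simplices, hK'] at hs
    obtain hs | ⟨C, hC, rfl⟩ := hs
    · exact hs.2
    · exact fun h => hC.2 (hAB.left_le_of_le_sup_right h)
  · intro C hC D hD hne
    rw [mem_simplices, hK']
    by_cases h : C = B
    · exact .inr ⟨D, hD, by rw [h, Finset.union_comm]⟩
    · refine .inl ⟨hdown ((hA C).2 (Finset.ssubset_iff_subset_ne.2 ⟨hC, h⟩)).2 ?_ hne,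
        fun h' => ?_⟩
      · rw [Finset.union_comm]
        exact Finset.union_subset_union_left hD.1
      · exact hD.2 (hAB.left_le_of_le_sup_left (h'.trans (Finset.union_subset_union_left hC)))
  · intro s hs h
    rw [mem_simplices] at hs
    exact hB (hdown hs h hB0)
  · intro C hC D hD hne
    rw [mem_simplices]
    exact hdown ((hA D).2 hD).2 (Finset.union_subset_union_left hC) hne

end FiniteComplex

theorem mainTheorem1 {G H L : Type*} [Group G] [Group H] [Group L]
    [Fintype G] [Fintype H] [Fintype L]
    [MulDistribMulAction G H] [MulDistribMulAction G L] (X : TwoCrossedModule G H L)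
    {V : Type*} [LinearOrder V] (K K' : FiniteComplex V)
    (hK : K.IsClosedCombinatorialManifold 4) (o : K.Orientation)
    (p q : ℕ) (hp : 1 ≤ p) (hq : 1 ≤ q) (hpq : p + q = 6)
    (hmove : FiniteComplex.IsPachnerMove p q K K') :
    K.stateSum X = K'.stateSum X := by
  exact FiniteComplex.stateSum_eq_of_isPachnerMove hp hq hpq hmove
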